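/- Let $\alpha>0$. An equilibrium is an odd, $2\pi$-periodic $C^2$ function $\psi:\mathbb R\to\mathbb R$ with $\alpha(\psi''-2\psi\psi')+2\psi=0$. Write $\psi_0\equiv 0$, and for an integer $j\ge 1$ let $\psi_j^{+}$ (resp. $\psi_j^{-}$) denote an equilibrium with fundamental period $2\pi/j$ and $\psi'(0)>0$ (resp. $\psi'(0)<0$). For an equilibrium $\psi$, let $$L[\psi]\zeta=-\alpha\zeta''+2\alpha\psi\zeta'-2(1-\alpha\psi')\zeta$$ be regarded as an unbounded operator on the (complexified) Hilbert space of odd $2\pi$-periodic functions that are square integrable on $(-\pi,\pi)$, with domain the odd $2\pi$-periodic functions of class $H^2$, and let $\sigma(L[\psi])\subset\mathbb C$ be its spectrum. **Theorem 4.3.** 1. If $\psi=\psi_0$ and $\alpha>2$, or $\psi=\psi_1^{\pm}$ and $\alpha<2$, then $\sigma(L[\psi])>0$, that is, there is $c>0$ such that $\sigma(L[\psi])\subset\{\lambda\in\mathbb R:\lambda\ge c\}$. 2. If $2/(k+1)^2\le\alpha<2/k^2$ for some integer $k\ge 1$, then for $\psi=\psi_0$ and for $\psi=\psi_j^{\pm}$,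 $j=2,\dots,k$, the operator $L[\psi]$ has a negative eigenvalue; in particular $\sigma(L[\psi])\cap\{\lambda\in\mathbb R:\lambda<0\}\ne\emptyset$. -/

import Mathlib

open MeasureTheory Set Function

noncomputable section

/-- Lebesgue measure on the interval `(-π, π)`. -/
abbrev muPi : Measure ℝ := volume.restrict (Ioo (-Real.pi) Real.pi)

theorem measurePreserving_neg_muPi : MeasurePreserving (fun x : ℝ => -x) muPi muPi := by
  have h := (Measure.measurePreserving_neg (volume : Measure ℝ)).restrict_preimage
    (s := Ioo (-Real.pi) Real.pi) measurableSet_Ioo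
  have e : (Neg.neg : ℝ → ℝ) ⁻¹' Ioo (-Real.pi) Real.pi = Ioo (-Real.pi) Real.pi := by
    ext x
    simp only [mem_preimage, mem_Ioo]
    constructor <;> rintro ⟨h1, h2⟩ <;> constructor <;> linarith
  rw [e] at h
  exact h

/-- The (complexified) Hilbert space of odd square integrable functions on `(-π, π)`, each of which
is identified with its `2π`-periodic extension. -/
def OddL2 : Submodule ℂ (Lp ℂ 2 muPi) where
  carrier := {f | ∀ᵐ x ∂muPi, f (-x) = -f x}
  zero_mem' := by
    have h := Lp.coeFn_zero ℂ 2 muPi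
    have h' := measurePreserving_neg_muPi.quasiMeasurePreserving.ae h
    change ∀ᵐ x ∂muPi, (0 : Lp ℂ 2 muPi) (-x) = -(0 : Lp ℂ 2 muPi) x
    filter_upwards [h, h'] with x hx hx'
    rw [hx, hx']
    simp
  add_mem' := by
    intro f g hf hg
    have h := Lp.coeFn_add f g
    have h' := measurePreserving_neg_muPi.quasiMeasurePreserving.ae h
    change ∀ᵐ x ∂muPi, (f + g) (-x) = -(f + g) x
    filter_upwards [h, h', hf, hg] with x hx hx' h1 h2
    rw [hx, hx', Pi.add_apply, Pi.add_apply, h1, h2]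
    ring
  smul_mem' := by
    intro c f hf
    have h := Lp.coeFn_smul c f
    have h' := measurePreserving_neg_muPi.quasiMeasurePreserving.ae h
    change ∀ᵐ x ∂muPi, (c • f) (-x) = -(c • f) x
    filter_upwards [h, h', hf] with x hx hx' h1
    rw [hx, hx', Pi.smul_apply, Pi.smul_apply, h1]
    simp

/-- `U` is an odd `2π`-periodic function of class `H²`, with first derivative `V` and second
derivative `W`: `U` is differentiable with derivative `V`, and `V` is the primitive on `[-π, π]` of
the square integrable function `W`. -/
structure IsOddPeriodicH2 (U V W : ℝ → ℂ) : Prop where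
  odd : ∀ x, U (-x) = -U x
  periodic : Periodic U (2 * Real.pi)
  hasDerivAt : ∀ x, HasDerivAt U (V x) x
  memLp : MemLp W 2 muPi
  eq_integral : ∀ x ∈ Icc (-Real.pi) Real.pi, V x = V 0 + ∫ t in (0 : ℝ)..x, W t

/-- The differential expression `-α U'' + 2 α ψ U' - 2 (1 - α ψ') U`, with `V` and `W` in the place
of `U'` and `U''`. -/
def linExpr (α : ℝ) (ψ : ℝ → ℝ) (U V W : ℝ → ℂ) (x : ℝ) : ℂ :=
  -(α : ℂ) * W x + 2 * (α : ℂ) * (ψ x : ℂ) * V x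
    - 2 * (1 - (α : ℂ) * ((deriv ψ x : ℝ) : ℂ)) * U x

theorem IsOddPeriodicH2.intervalIntegrable {U V W : ℝ → ℂ} (h : IsOddPeriodicH2 U V W)
    {x : ℝ} (hx : x ∈ Icc (-Real.pi) Real.pi) : IntervalIntegrable W volume 0 x := by
  have h1 : IntegrableOn W (Ioo (-Real.pi) Real.pi) volume :=
    h.memLp.integrable (by norm_num)
  have h2 : IntegrableOn W (Icc (-Real.pi) Real.pi) volume :=
    (integrableOn_Icc_iff_integrableOn_Ioo).2 h1
  have h3 : uIcc 0 x ⊆ Icc (-Real.pi) Real.pi :=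
    uIcc_subset_Icc ⟨by linarith [Real.pi_pos], Real.pi_pos.le⟩ hx
  exact (h2.mono_set h3).intervalIntegrable

/-- The graph of the linearized operator: the pairs `(u, g)` of elements of `OddL2` such that `u` is
(the class of) an odd `2π`-periodic function of class `H²` and
`g = -α u'' + 2 α ψ u' - 2 (1 - α ψ') u`. -/
def linGraph (α : ℝ) (ψ : ℝ → ℝ) : Submodule ℂ (OddL2 × OddL2) where
  carrier := {q | ∃ U V W : ℝ → ℂ, IsOddPeriodicH2 U V W ∧
    (q.1 : Lp ℂ 2 muPi) =ᵐ[muPi] U ∧ (q.2 : Lp ℂ 2 muPi) =ᵐ[muPi] linExpr α ψ U V W}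
  zero_mem' := by
    refine ⟨0, 0, 0, ⟨by simp, fun x => by simp, fun x => hasDerivAt_const x (0 : ℂ),
      MemLp.zero, by simp⟩, Lp.coeFn_zero ℂ 2 muPi, ?_⟩
    refine (Lp.coeFn_zero ℂ 2 muPi).trans (Filter.Eventually.of_forall fun x => ?_)
    simp [linExpr]
  add_mem' := by
    rintro ⟨u, g⟩ ⟨u', g'⟩ ⟨U, V, W, h, hu, hg⟩ ⟨U', V', W', h', hu', hg'⟩
    refine ⟨U + U', V + V', W + W', ⟨?_, ?_, ?_, h.memLp.add h'.memLp, ?_⟩, ?_, ?_⟩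
    · intro x
      simp only [Pi.add_apply, h.odd, h'.odd]
      ring
    · exact h.periodic.add h'.periodic
    · intro x
      exact (h.hasDerivAt x).add (h'.hasDerivAt x)
    · intro x hx
      simp only [Pi.add_apply]
      rw [intervalIntegral.integral_add (h.intervalIntegrable hx) (h'.intervalIntegrable hx),
        h.eq_integral x hx, h'.eq_integral x hx]
      ring
    · exact (Lp.coeFn_add (u : Lp ℂ 2 muPi) u').trans (hu.add hu')
    · refine (Lp.coeFn_add (g : Lp ℂ 2 muPi) g').trans ((hg.add hg').trans ?_)
      refine Filter.Eventually.of_forall fun x => ?_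
      simp only [linExpr, Pi.add_apply]
      ring
  smul_mem' := by
    rintro c ⟨u, g⟩ ⟨U, V, W, h, hu, hg⟩
    refine ⟨c • U, c • V, c • W, ⟨?_, ?_, ?_, h.memLp.const_smul c, ?_⟩, ?_, ?_⟩
    · intro x
      simp [h.odd]
    · intro x
      simp [h.periodic x]
    · intro x
      exact (h.hasDerivAt x).const_smul c
    · intro x hx
      simp only [Pi.smul_apply]
      rw [intervalIntegral.integral_smul, h.eq_integral x hx, smul_add]
    · exact (Lp.coeFn_smul c (u : Lp ℂ 2 muPi)).trans (hu.const_smul c)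
    · refine (Lp.coeFn_smul c (g : Lp ℂ 2 muPi)).trans ((hg.const_smul c).trans ?_)
      refine Filter.Eventually.of_forall fun x => ?_
      simp only [linExpr, Pi.smul_apply, smul_eq_mul]
      ring

/-- The linearized operator `L[ψ] ζ = -α ζ'' + 2 α ψ ζ' - 2 (1 - α ψ') ζ`, as an unbounded linear
operator in `OddL2` whose domain consists of the odd `2π`-periodic functions of class `H²`. -/
def linOp (α : ℝ) (ψ : ℝ → ℝ) : OddL2 →ₗ.[ℂ] OddL2 := (linGraph α ψ).toLinearPMap

/-- `linGraph` is single-valued, so it really is the graph of `linOp`. -/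
theorem linGraph_singleValued (α : ℝ) (ψ : ℝ → ℝ) :
    ∀ q : OddL2 × OddL2, q ∈ linGraph α ψ → q.1 = 0 → q.2 = 0 := by
  rintro ⟨u, g⟩ ⟨U, V, W, h, hu, hg⟩ h0
  simp only at h0 hu hg
  subst h0
  have hπ := Real.pi_pos
  have hUc : Continuous U :=
    continuous_iff_continuousAt.2 fun x => (h.hasDerivAt x).continuousAt
  have hU0 : U =ᵐ[muPi] 0 := hu.symm.trans (Lp.coeFn_zero ℂ 2 muPi)
  have hU : EqOn U 0 (Ioo (-Real.pi) Real.pi) :=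
    Measure.eqOn_open_of_ae_eq hU0 isOpen_Ioo hUc.continuousOn continuousOn_const
  have hV : EqOn V 0 (Ioo (-Real.pi) Real.pi) := by
    intro x hx
    have e : U =ᶠ[nhds x] fun _ => (0 : ℂ) :=
      Filter.eventuallyEq_of_mem (isOpen_Ioo.mem_nhds hx) hU
    exact (h.hasDerivAt x).unique ((hasDerivAt_const x (0 : ℂ)).congr_of_eventuallyEq e)
  have hV0 : V 0 = 0 := hV ⟨by linarith, hπ⟩
  have hI : ∀ x ∈ Ioo (-Real.pi) Real.pi, ∫ t in (0 : ℝ)..x, W t = 0 := by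
    intro x hx
    have := h.eq_integral x ⟨hx.1.le, hx.2.le⟩
    rw [hV hx, hV0] at this
    simpa using this.symm
  have hW : W =ᵐ[muPi] 0 := by
    have hint : IntervalIntegrable W volume (-Real.pi) Real.pi :=
      (h.intervalIntegrable (x := -Real.pi) ⟨le_rfl, by linarith⟩).symm.trans
        (h.intervalIntegrable ⟨by linarith, le_rfl⟩)
    have hd := hint.ae_hasDerivAt_integral
    rw [Filter.EventuallyEq, ae_restrict_iff' measurableSet_Ioo]
    filter_upwards [hd] with x hx hxI
    have h1 := hx (by rw [uIcc_of_le (by linarith)]; exact ⟨hxI.1.le, hxI.2.le⟩) 0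
      (by rw [uIcc_of_le (by linarith)]; exact ⟨by linarith, hπ.le⟩)
    have e : (fun y => ∫ t in (0 : ℝ)..y, W t) =ᶠ[nhds x] fun _ => (0 : ℂ) :=
      Filter.eventuallyEq_of_mem (isOpen_Ioo.mem_nhds hxI) hI
    exact h1.unique ((hasDerivAt_const x (0 : ℂ)).congr_of_eventuallyEq e)
  apply Subtype.ext
  apply Lp.ext
  refine hg.trans (Filter.EventuallyEq.trans ?_ (Lp.coeFn_zero ℂ 2 muPi).symm)
  filter_upwards [hW, ae_restrict_mem measurableSet_Ioo] with x hx hxI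
  simp [linExpr, hx, hU hxI, hV hxI]

theorem linOp_graph (α : ℝ) (ψ : ℝ → ℝ) : (linOp α ψ).graph = linGraph α ψ :=
  Submodule.toLinearPMap_graph_eq _ (linGraph_singleValued α ψ)

/-- The spectrum of an unbounded operator `T` in a complex normed space: the complement of the set of
those `z` for which `T - z` maps the domain of `T` bijectively onto the whole space with a bounded
inverse `R`. -/
def unboundedSpectrum {E : Type*} [NormedAddCommGroup E] [NormedSpace ℂ E] (T : E →ₗ.[ℂ] E) :
    Set ℂ :=
  {z | ∃ R : E →L[ℂ] E, (∀ f : E, ∃ hf : R f ∈ T.domain, T ⟨R f, hf⟩ - z • R f = f) ∧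
    ∀ u : T.domain, R (T u - z • (u : E)) = u}ᶜ

/-- `z` is an eigenvalue of the unbounded operator `T`. -/
def IsUnboundedEigenvalue {E : Type*} [NormedAddCommGroup E] [NormedSpace ℂ E] (T : E →ₗ.[ℂ] E)
    (z : ℂ) : Prop :=
  ∃ u : T.domain, (u : E) ≠ 0 ∧ T u = z • (u : E)

/-- Equilibrium solutions: odd `2π`-periodic solutions of `α (ψ'' - 2 ψ ψ') + 2 ψ = 0`. -/
structure IsEquilibrium (α : ℝ) (ψ : ℝ → ℝ) : Prop where
  contDiff : ContDiff ℝ 2 ψ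
  odd : ∀ x, ψ (-x) = -ψ x
  periodic : Periodic ψ (2 * Real.pi)
  equation : ∀ x, α * (deriv (deriv ψ) x - 2 * ψ x * deriv ψ x) + 2 * ψ x = 0

/-- `T` is the fundamental (smallest positive) period of `ψ`. -/
def IsFundamentalPeriod (ψ : ℝ → ℝ) (T : ℝ) : Prop :=
  IsLeast {t : ℝ | 0 < t ∧ Periodic ψ t} T

/-- `ψ` is the equilibrium solution `ψ_j^+`: fundamental period `2π/j` and positive slope at `0`. -/
structure IsPsiPlus (α : ℝ) (j : ℕ) (ψ : ℝ → ℝ) : Prop where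
  isEquilibrium : IsEquilibrium α ψ
  fundamentalPeriod : IsFundamentalPeriod ψ (2 * Real.pi / j)
  slope : 0 < deriv ψ 0

/-- `ψ` is the equilibrium solution `ψ_j^-`: fundamental period `2π/j` and negative slope at `0`;
it is the translate of `ψ_j^+` by half of the fundamental period. -/
structure IsPsiMinus (α : ℝ) (j : ℕ) (ψ : ℝ → ℝ) : Prop where
  isEquilibrium : IsEquilibrium α ψ
  fundamentalPeriod : IsFundamentalPeriod ψ (2 * Real.pi / j)
  slope : deriv ψ 0 < 0

end

noncomputable section

/-! ### Absolutely continuous complex functions -/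

/-! Everything rests on the weight `s = 1 - α ψ'`. The equilibrium equation says `s' = 2 ψ s`, and
`s = 1` at a critical point of `ψ`, so `s > 0` (`IsEquilibrium.isGauge`). Hence `L ζ = -α s (ζ'/s)'
- 2 s ζ`, which is symmetric for the inner product with density `1/s`.

Spectral theory. Odd periodic functions vanish at `0` and `π`, so `A u = -α s (u'/s)'` has an
explicit inverse, the compact operator `IsGauge.green`. Since `L - z = (1 - T) A` with `T = (2 s +
z) A⁻¹` compact, the Fredholm alternative shows that the spectrum consists of eigenvalues, and these
are real by symmetry.

Positivity. If `v > 0` on `(0, π)` and `L v ≥ c v` there, a Wronskian argument on a nodal interval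
shows that every eigenvalue is at least `c` (`IsGauge.spectrum_of_supersolution`). At `ψ = 0`, `v =
sin` works with `c = α - 2`. For `ψ₁^±`, symmetry about zeros excludes zeros in `(0, π)`. The
function `ψ (2 + s)` satisfies `L (ψ (2 + s)) = 4 ψ (1 - s)²`, which degenerates only where `s = 1`;
the correction `-ε ψ (1 - s)²` removes this degeneracy (`IsEquilibrium.spectrum_pos`).

Negativity. At `ψ = 0`, `sin` is an eigenfunction for `α - 2`. Otherwise `L (s - s 0) = -2 α ψ'(0)
s`. When a period `P` fits into `[0, π]`, truncating `s - s 0` at `P` and extending oddly gives an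
`H²` function whose weighted form is `-4 (α ψ'(0))² P < 0`. A negative value of the form yields a
negative eigenvalue by the spectral theorem for the compact self-adjoint operator similar to `(L +
1)⁻¹` (`IsGauge.exists_neg_eigenvalue`). -/

theorem AbsolutelyContinuousOnInterval.complex_ofReal {f : ℝ → ℝ} {a b : ℝ}
    (hf : AbsolutelyContinuousOnInterval f a b) :
    AbsolutelyContinuousOnInterval (fun x => (f x : ℂ)) a b := by
  unfold AbsolutelyContinuousOnInterval at hf ⊢
  simpa only [Complex.isometry_ofReal.dist_eq] using hf

/-- The primitive of an integrable complex function is absolutely continuous. -/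
theorem absolutelyContinuousOnInterval_primitive {h : ℝ → ℂ} {a b c : ℝ}
    (hh : IntervalIntegrable h volume a b) (hc : c ∈ uIcc a b) :
    AbsolutelyContinuousOnInterval (fun x => ∫ t in c..x, h t) a b := by
  have hre : IntervalIntegrable (fun t => (h t).re) volume a b := ⟨hh.1.re, hh.2.re⟩
  have him : IntervalIntegrable (fun t => (h t).im) volume a b := ⟨hh.1.im, hh.2.im⟩
  have h1 := (hre.absolutelyContinuousOnInterval_intervalIntegral hc).complex_ofReal
  have h2 := (him.absolutelyContinuousOnInterval_intervalIntegral hc).complex_ofReal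
  have h3 := h1.add (h2.const_smul Complex.I)
  have key : ∀ x ∈ uIcc a b, (∫ t in c..x, h t) =
      ((∫ t in c..x, (h t).re : ℝ) : ℂ) + Complex.I • ((∫ t in c..x, (h t).im : ℝ) : ℂ) := by
    intro x hx
    have hsub : uIcc c x ⊆ uIcc a b := uIcc_subset_uIcc hc hx
    have i1 : IntervalIntegrable (fun t => ((h t).re : ℂ)) volume c x :=
      ⟨(hre.mono_set hsub).1.ofReal, (hre.mono_set hsub).2.ofReal⟩
    have i2 : IntervalIntegrable (fun t => Complex.I * ((h t).im : ℂ)) volume c x :=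
      IntervalIntegrable.const_mul ⟨(him.mono_set hsub).1.ofReal, (him.mono_set hsub).2.ofReal⟩ _
    rw [smul_eq_mul, ← intervalIntegral.integral_ofReal, ← intervalIntegral.integral_ofReal,
      ← intervalIntegral.integral_const_mul, ← intervalIntegral.integral_add i1 i2]
    refine intervalIntegral.integral_congr fun t _ => ?_
    simp [mul_comm Complex.I, Complex.re_add_im]
  -- The two functions agree only on `uIcc a b`, so absolute continuity is transferred through the
  -- `ε`-`δ` form, which evaluates them only at points of that interval.
  refine (absolutelyContinuousOnInterval_iff _ _ _).2 fun ε hε => ?_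
  obtain ⟨δ, hδ, H⟩ := (absolutelyContinuousOnInterval_iff _ _ _).1 h3 ε hε
  refine ⟨δ, hδ, fun E hE hs => ?_⟩
  have := H E hE hs
  refine lt_of_eq_of_lt (Finset.sum_congr rfl fun i hi => ?_) this
  have hE' := hE.1 i (Finset.mem_range.1 hi |> Finset.mem_range.2)
  simp only [Pi.add_apply]
  rw [key _ hE'.1, key _ hE'.2]

/-- The product rule, in integrated form, for a `C¹` function and a primitive of an integrable
function. -/
theorem integral_deriv_mul_primitive {p p' H h : ℝ → ℂ} {a b : ℝ}
    (hp : ∀ x ∈ uIcc a b, HasDerivAt p (p' x) x) (hp' : ContinuousOn p' (uIcc a b))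
    (hh : IntervalIntegrable h volume a b) (hH : ∀ x ∈ uIcc a b, H x = H a + ∫ t in a..x, h t) :
    ∫ t in a..b, (p' t * H t + p t * h t) = p b * H b - p a * H a := by
  have hpc : ContinuousOn p (uIcc a b) := fun x hx => (hp x hx).continuousAt.continuousWithinAt
  have hprim := absolutelyContinuousOnInterval_primitive hh left_mem_uIcc
  have hHc : ContinuousOn H (uIcc a b) :=
    (continuousOn_const.add hprim.continuousOn).congr hH
  have hi : IntervalIntegrable (fun t => p' t * H t + p t * h t) volume a b :=
    (hp'.mul hHc).intervalIntegrable.add (hh.continuousOn_mul hpc)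
  have hpac : AbsolutelyContinuousOnInterval (fun x => ∫ t in a..x, p' t) a b :=
    absolutelyContinuousOnInterval_primitive hp'.intervalIntegrable left_mem_uIcc
  have hpeq : ∀ x ∈ uIcc a b, p x = p a + ∫ t in a..x, p' t := by
    intro x hx
    have hsub : uIcc a x ⊆ uIcc a b := uIcc_subset_uIcc left_mem_uIcc hx
    rw [intervalIntegral.integral_eq_sub_of_hasDerivAt (fun t ht => hp t (hsub ht))
      (hp'.mono hsub).intervalIntegrable]
    ring
  have hconst : ∀ c : ℂ, AbsolutelyContinuousOnInterval (fun _ => c) a b := fun c =>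
    (LipschitzWith.const c).lipschitzOnWith.absolutelyContinuousOnInterval
  -- The difference of the two sides, as a function of the upper limit, is absolutely continuous
  -- with derivative zero almost everywhere, hence constant.
  have hac : AbsolutelyContinuousOnInterval (fun x => (p a + ∫ t in a..x, p' t) *
      (H a + ∫ t in a..x, h t) - ∫ t in a..x, (p' t * H t + p t * h t)) a b :=
    (((hconst (p a)).add hpac).smul ((hconst (H a)).add hprim)).sub
      (absolutelyContinuousOnInterval_primitive hi left_mem_uIcc)
  have hzero : ∀ᵐ x, x ∈ uIcc a b → HasDerivAt (fun x => (p a + ∫ t in a..x, p' t) *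
      (H a + ∫ t in a..x, h t) - ∫ t in a..x, (p' t * H t + p t * h t)) 0 x := by
    filter_upwards [hh.ae_hasDerivAt_integral, hi.ae_hasDerivAt_integral,
      hp'.intervalIntegrable.ae_hasDerivAt_integral] with x h1 h2 h3 hx
    have d1 := (h1 hx a left_mem_uIcc).const_add (H a)
    have d2 := h2 hx a left_mem_uIcc
    have d3 := (h3 hx a left_mem_uIcc).const_add (p a)
    have := (d3.mul d1).sub d2
    rw [← hpeq x hx, ← hH x hx, sub_self] at this
    exact this
  obtain ⟨C, hC⟩ := hac.const_of_ae_hasDerivAt_zero hzero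
  have ea := hC a left_mem_uIcc
  have eb := hC b right_mem_uIcc
  rw [← hpeq b right_mem_uIcc, ← hH b right_mem_uIcc] at eb
  rw [← ea] at eb
  simp only [intervalIntegral.integral_same, add_zero, sub_zero] at eb
  rw [← eb]
  ring

/-! ### Multiplication operators and compact embeddings in `L²(-π, π)` -/

/-- Reflection acts on `L²` as an isometry, and oddness is the closed condition that it agrees with
`-f`. The resulting completeness is what the spectral theory of compact operators needs. -/
theorem isClosed_OddL2 : IsClosed (OddL2 : Set (Lp ℂ 2 muPi)) := by
  have h : (OddL2 : Set (Lp ℂ 2 muPi)) = {f | Lp.compMeasurePreservingₗᵢ ℂ (fun x : ℝ => -x)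
      measurePreserving_neg_muPi f = -f} := by
    ext f
    have h1 := Lp.coeFn_compMeasurePreserving f measurePreserving_neg_muPi
    have h2 := Lp.coeFn_neg f
    change (∀ᵐ x ∂muPi, f (-x) = -f x) ↔ _
    rw [mem_ofPred_eq, Lp.ext_iff]
    constructor
    · intro h
      refine h1.trans ?_
      filter_upwards [h, h2] with x hx hx2
      rw [hx2, Pi.neg_apply, ← hx, comp_apply]
    · intro h
      filter_upwards [h, h1, h2] with x hx hx1 hx2
      have e := hx1.symm.trans (hx.trans hx2)
      simpa using e
  rw [h]
  exact isClosed_eq (LinearIsometry.continuous _) continuous_neg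

instance : CompleteSpace OddL2 := isClosed_OddL2.completeSpace_coe

instance : IsFiniteMeasure muPi := ⟨by simp⟩

theorem exists_norm_le_of_continuous {m : ℝ → ℂ} (hm : Continuous m) :
    ∃ C : ℝ, 0 ≤ C ∧ ∀ x ∈ Icc (-Real.pi) Real.pi, ‖m x‖ ≤ C := by
  obtain ⟨C, hC⟩ := isCompact_Icc.exists_bound_of_continuousOn (s := Icc (-Real.pi) Real.pi)
    hm.continuousOn
  exact ⟨|C|, abs_nonneg _, fun x hx => (hC x hx).trans (le_abs_self _)⟩

theorem memLp_of_continuous {m : ℝ → ℂ} (hm : Continuous m) (p : ENNReal) : MemLp m p muPi := by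
  obtain ⟨C, -, hC⟩ := exists_norm_le_of_continuous hm
  refine MemLp.of_bound hm.aestronglyMeasurable C ?_
  filter_upwards [ae_restrict_mem measurableSet_Ioo] with x hx
  exact hC x (Ioo_subset_Icc_self hx)

/-- Multiplication by a continuous function, as an operator in `L²(-π, π)`. -/
def mulLp (m : ℝ → ℂ) (hm : Continuous m) : Lp ℂ 2 muPi →L[ℂ] Lp ℂ 2 muPi :=
  (ContinuousLinearMap.mul ℂ ℂ).holderL muPi ⊤ 2 2 ((memLp_of_continuous hm ⊤).toLp m)

theorem coeFn_mulLp (m : ℝ → ℂ) (hm : Continuous m) (f : Lp ℂ 2 muPi) :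
    mulLp m hm f =ᵐ[muPi] fun x => m x * f x := by
  have h1 := (ContinuousLinearMap.mul ℂ ℂ).coeFn_holder (r := 2)
    ((memLp_of_continuous hm ⊤).toLp m) f
  refine Filter.EventuallyEq.trans (f := mulLp m hm f) h1 ?_
  · filter_upwards [(memLp_of_continuous hm ⊤).coeFn_toLp] with x hx
    simp [hx]

theorem ae_neg_of_OddL2 (f : OddL2) : ∀ᵐ x ∂muPi, (f : Lp ℂ 2 muPi) (-x) = -(f : Lp ℂ 2 muPi) x :=
  f.2

/-- Multiplication by a continuous even function, as an operator in `OddL2`. -/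
def mulOdd (m : ℝ → ℂ) (hm : Continuous m) (he : ∀ x, m (-x) = m x) : OddL2 →L[ℂ] OddL2 :=
  ((mulLp m hm).comp OddL2.subtypeL).codRestrict OddL2 <| by
    intro f
    change ∀ᵐ x ∂muPi, mulLp m hm f (-x) = -mulLp m hm f x
    have h := coeFn_mulLp m hm f
    filter_upwards [h, measurePreserving_neg_muPi.quasiMeasurePreserving.ae h, ae_neg_of_OddL2 f]
      with x h1 h2 h3
    rw [h1, h2, he, h3]
    ring

theorem coeFn_mulOdd (m : ℝ → ℂ) (hm : Continuous m) (he : ∀ x, m (-x) = m x) (f : OddL2) :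
    (mulOdd m hm he f : Lp ℂ 2 muPi) =ᵐ[muPi] fun x => m x * (f : Lp ℂ 2 muPi) x :=
  coeFn_mulLp m hm f

theorem OddL2_ext {f g : OddL2} (h : (f : Lp ℂ 2 muPi) =ᵐ[muPi] (g : Lp ℂ 2 muPi)) : f = g :=
  Subtype.ext (Lp.ext h)

/-- The class in `L²(-π, π)` of a bounded continuous function on `[-π, π]`. -/
def ofIcc (k : BoundedContinuousFunction (Icc (-Real.pi) Real.pi) ℂ) : Lp ℂ 2 muPi :=
  BoundedContinuousFunction.toLp 2 muPi ℂ (k.compContinuous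
    ⟨projIcc (-Real.pi) Real.pi (by linarith [Real.pi_pos]), continuous_projIcc⟩)

theorem continuous_ofIcc : Continuous ofIcc :=
  (BoundedContinuousFunction.toLp 2 muPi ℂ).continuous.comp
    (BoundedContinuousFunction.continuous_compContinuous _)

theorem coeFn_ofIcc (k : BoundedContinuousFunction (Icc (-Real.pi) Real.pi) ℂ) {U : ℝ → ℂ}
    (hU : ∀ x, k x = U x) : ofIcc k =ᵐ[muPi] U := by
  refine (BoundedContinuousFunction.coeFn_toLp 2 muPi ℂ _).trans ?_
  filter_upwards [ae_restrict_mem measurableSet_Ioo] with x hx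
  simp only [BoundedContinuousFunction.compContinuous_apply, ContinuousMap.coe_mk, hU]
  rw [projIcc_of_mem _ (Ioo_subset_Icc_self hx)]

/-- The classes of the functions which are bounded and Lipschitz on `[-π, π]`, with a given
constant, lie in a compact subset of `L²(-π, π)`. -/
theorem exists_isCompact_lipschitz (C : ℝ) : ∃ K : Set (Lp ℂ 2 muPi), IsCompact K ∧
    ∀ f : Lp ℂ 2 muPi, ∀ U : ℝ → ℂ, f =ᵐ[muPi] U →
      (∀ x ∈ Icc (-Real.pi) Real.pi, ‖U x‖ ≤ C) → (∀ x ∈ Icc (-Real.pi) Real.pi,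
        ∀ y ∈ Icc (-Real.pi) Real.pi, dist (U x) (U y) ≤ C * dist x y) → f ∈ K := by
  have hπ := Real.pi_pos
  let A : Set (BoundedContinuousFunction (Icc (-Real.pi) Real.pi) ℂ) :=
    {k | (∀ x, ‖k x‖ ≤ C) ∧ ∀ x y, dist (k x) (k y) ≤ C * dist x y}
  have hev : ∀ x, Continuous fun k : BoundedContinuousFunction (Icc (-Real.pi) Real.pi) ℂ => k x :=
    fun x => continuous_eval_const x
  have hclosed : IsClosed A := by
    simp only [A, ofPred_and, ofPred_forall]
    exact (isClosed_iInter fun x => isClosed_le (hev x).norm continuous_const).inter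
      (isClosed_iInter fun x => isClosed_iInter fun y =>
        isClosed_le ((hev x).dist (hev y)) continuous_const)
  -- Arzelà–Ascoli: pointwise bounds and a common Lipschitz constant give compactness in the uniform
  -- topology, which the continuous map `ofIcc` carries to `L²`.
  have hA : IsCompact A := by
    refine BoundedContinuousFunction.arzela_ascoli₂ (Metric.closedBall 0 C)
      (isCompact_closedBall _ _) A hclosed (fun k x hk => ?_) ?_
    · simpa using hk.1 x
    · refine Metric.equicontinuous_of_continuity_modulus (fun d => C * d) ?_ _ ?_
      · exact (continuous_const.mul continuous_id).tendsto' _ _ (by simp)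
      · intro x y k
        exact k.2.2 x y
  refine ⟨ofIcc '' A, hA.image continuous_ofIcc, fun f U hf hb hl => ?_⟩
  have hUc : Continuous fun x : Icc (-Real.pi) Real.pi => U x := by
    have hL : LipschitzWith (Real.toNNReal C) fun x : Icc (-Real.pi) Real.pi => U x :=
      LipschitzWith.of_dist_le_mul fun x y => by
        have hC : 0 ≤ C := (norm_nonneg _).trans (hb 0 ⟨by linarith, hπ.le⟩)
        rw [Real.coe_toNNReal C hC]
        exact hl x x.2 y y.2
    exact hL.continuous
  refine ⟨BoundedContinuousFunction.mkOfCompact ⟨_, hUc⟩, ⟨fun x => hb x x.2,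
    fun x y => hl x x.2 y y.2⟩, ?_⟩
  exact Lp.ext ((coeFn_ofIcc _ fun x => rfl).trans hf.symm)

/-- Cauchy–Schwarz against the indicator of `t`. -/
theorem norm_setIntegral_muPi_le (f : Lp ℂ 2 muPi) {t : Set ℝ} (ht : MeasurableSet t) :
    ‖∫ x in t, f x ∂muPi‖ ≤ (2 * Real.pi) ^ (1 / 2 : ℝ) * ‖f‖ := by
  have hfin : muPi t ≠ ⊤ := measure_ne_top _ _
  rw [← L2.inner_indicatorConstLp_one (𝕜 := ℂ) ht hfin f]
  refine (norm_inner_le_norm _ _).trans (mul_le_mul_of_nonneg_right ?_ (norm_nonneg _))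
  refine norm_indicatorConstLp_le.trans ?_
  rw [norm_one, one_mul]
  refine (Real.rpow_le_rpow measureReal_nonneg (measureReal_mono (subset_univ t)) (by simp)).trans ?_
  simp only [measureReal_restrict_apply_univ, Real.volume_real_Ioo_of_le
    (by linarith [Real.pi_pos] : -Real.pi ≤ Real.pi)]
  apply le_of_eq
  norm_num
  ring_nf

theorem norm_intervalIntegral_muPi_le (f : Lp ℂ 2 muPi) (a b : ℝ) :
    ‖∫ x in a..b, f x ∂muPi‖ ≤ (2 * Real.pi) ^ (1 / 2 : ℝ) * ‖f‖ := by
  rw [intervalIntegral.norm_intervalIntegral_eq]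
  exact norm_setIntegral_muPi_le f measurableSet_uIoc

theorem intervalIntegral_muPi {h : ℝ → ℂ} {a b : ℝ} (ha : a ∈ Icc (-Real.pi) Real.pi)
    (hb : b ∈ Icc (-Real.pi) Real.pi) : ∫ x in a..b, h x ∂muPi = ∫ x in a..b, h x := by
  have key : ∀ c d : ℝ, c ∈ Icc (-Real.pi) Real.pi → d ∈ Icc (-Real.pi) Real.pi →
      ∫ x in Ioc c d, h x ∂muPi = ∫ x in Ioc c d, h x := by
    intro c d hc hd
    rw [Measure.restrict_restrict measurableSet_Ioc]
    refine setIntegral_congr_set ((ae_eq_set_inter (ae_eq_refl _) Ioo_ae_eq_Ioc).trans ?_)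
    rw [inter_eq_left.2 (Ioc_subset_Ioc hc.1 hd.2)]
    exact ae_eq_refl _
  rw [intervalIntegral, intervalIntegral, key a b ha hb, key b a hb ha]

/-! ### Odd periodic functions of class `H²` -/

theorem Function.Periodic.forall_of_Icc {P : ℝ → Prop} (hP : ∀ x, P (x + 2 * Real.pi) ↔ P x)
    (h : ∀ x ∈ Icc (-Real.pi) Real.pi, P x) (x : ℝ) : P x := by
  have hper : Periodic P (2 * Real.pi) := fun x => propext (hP x)
  obtain ⟨y, hy, hxy⟩ := hper.exists_mem_Ico (by linarith [Real.pi_pos]) x (-Real.pi)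
  rw [hxy]
  exact h y ⟨hy.1, by linarith [hy.2]⟩

/-- A continuous even function on `[-π, π]` with vanishing mean, which is a primitive of a square
integrable function, is the derivative of an odd periodic function of class `H²`. -/
theorem exists_isOddPeriodicH2 {v W : ℝ → ℂ} (hv : Continuous v)
    (heven : ∀ x ∈ Icc (-Real.pi) Real.pi, v (-x) = v x) (hmean : ∫ t in (-Real.pi)..Real.pi, v t = 0)
    (hW : MemLp W 2 muPi) (hvW : ∀ x ∈ Icc (-Real.pi) Real.pi, v x = v 0 + ∫ t in (0 : ℝ)..x, W t) :
    ∃ U V : ℝ → ℂ, IsOddPeriodicH2 U V W ∧ ∀ x ∈ Icc (-Real.pi) Real.pi,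
      V x = v x ∧ U x = ∫ t in (0 : ℝ)..x, v t := by
  have hπ := Real.pi_pos
  have : Fact (0 < 2 * Real.pi) := ⟨by linarith⟩
  -- Evenness matches the values at the two ends, so the periodic extension of `v` is continuous;
  -- the vanishing mean will make its primitive periodic.
  have hend : v (-Real.pi) = v (-Real.pi + 2 * Real.pi) := by
    rw [heven Real.pi ⟨by linarith, le_rfl⟩]
    congr 1
    ring
  let V : ℝ → ℂ := fun x => AddCircle.liftIco (2 * Real.pi) (-Real.pi) v (x : AddCircle (2 * Real.pi))
  have hVc : Continuous V :=
    (AddCircle.liftIco_continuous hend hv.continuousOn).comp (AddCircle.continuous_mk' _)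
  have hVper : Periodic V (2 * Real.pi) := fun x => by
    simp only [V, AddCircle.coe_add_period]
  have hVIco : ∀ x ∈ Ico (-Real.pi) Real.pi, V x = v x := fun x hx =>
    AddCircle.liftIco_coe_apply ⟨hx.1, by linarith [hx.2]⟩
  have hV : ∀ x ∈ Icc (-Real.pi) Real.pi, V x = v x := by
    intro x hx
    rcases hx.2.lt_or_eq with h | rfl
    · exact hVIco x ⟨hx.1, h⟩
    · have e := hVper (-Real.pi)
      rw [show -Real.pi + 2 * Real.pi = Real.pi by ring] at e hend
      rw [e, hVIco _ ⟨le_rfl, by linarith⟩, hend]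
  have h0 : (0 : ℝ) ∈ Icc (-Real.pi) Real.pi := ⟨by linarith, hπ.le⟩
  have hUI : ∀ x ∈ Icc (-Real.pi) Real.pi, ∫ t in (0 : ℝ)..x, V t = ∫ t in (0 : ℝ)..x, v t :=
    fun x hx => intervalIntegral.integral_congr fun t ht => hV t (uIcc_subset_Icc h0 hx ht)
  have hint : ∀ a b : ℝ, IntervalIntegrable V volume a b := fun a b => hVc.intervalIntegrable a b
  have hUper : Periodic (fun x => ∫ t in (0 : ℝ)..x, V t) (2 * Real.pi) := by
    intro x
    have h1 := intervalIntegral.integral_add_adjacent_intervals (hint 0 x) (hint x (x + 2 * Real.pi))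
    have h2 := hVper.intervalIntegral_add_eq x (-Real.pi)
    have h3 : ∫ t in (-Real.pi)..(-Real.pi + 2 * Real.pi), V t = 0 := by
      rw [show -Real.pi + 2 * Real.pi = Real.pi by ring, ← hmean]
      exact intervalIntegral.integral_congr fun t ht =>
        hV t (by rwa [uIcc_of_le (by linarith)] at ht)
    simp only
    rw [← h1, h2, h3, add_zero]
  have hodd : ∀ x, ∫ t in (0 : ℝ)..(-x), V t = -∫ t in (0 : ℝ)..x, V t := by
    refine Function.Periodic.forall_of_Icc (fun x => ?_) fun x hx => ?_
    · have e1 : ∫ t in (0 : ℝ)..(-(x + 2 * Real.pi)), V t = ∫ t in (0 : ℝ)..(-x), V t := by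
        have := hUper (-(x + 2 * Real.pi))
        simp only at this
        rw [← this]
        congr 1
        ring
      have e2 : ∫ t in (0 : ℝ)..(x + 2 * Real.pi), V t = ∫ t in (0 : ℝ)..x, V t := hUper x
      rw [e1, e2]
    · have hx' : -x ∈ Icc (-Real.pi) Real.pi := ⟨by linarith [hx.2], by linarith [hx.1]⟩
      rw [hUI x hx, hUI _ hx']
      have := intervalIntegral.integral_comp_neg (a := 0) (b := x) v
      rw [neg_zero, intervalIntegral.integral_symm 0 (-x)] at this
      rw [← neg_eq_iff_eq_neg, ← this]
      exact intervalIntegral.integral_congr fun t ht => heven t (uIcc_subset_Icc h0 hx ht)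
  refine ⟨fun x => ∫ t in (0 : ℝ)..x, V t, V, ⟨hodd, hUper, fun x => ?_, hW, fun x hx => ?_⟩,
    fun x hx => ⟨hV x hx, hUI x hx⟩⟩
  · exact intervalIntegral.integral_hasDerivAt_right (hint 0 x)
      (hVc.stronglyMeasurableAtFilter _ _) hVc.continuousAt
  · rw [hV x hx, hV 0 h0, hvW x hx]

theorem IsOddPeriodicH2.apply_zero {U V W : ℝ → ℂ} (h : IsOddPeriodicH2 U V W) : U 0 = 0 := by
  have := h.odd 0
  rw [neg_zero] at this
  exact self_eq_neg.1 this

theorem IsOddPeriodicH2.apply_pi {U V W : ℝ → ℂ} (h : IsOddPeriodicH2 U V W) : U Real.pi = 0 := by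
  have h1 := h.odd Real.pi
  have h2 := h.periodic (-Real.pi)
  rw [show -Real.pi + 2 * Real.pi = Real.pi by ring, h1] at h2
  exact self_eq_neg.1 h2

theorem IsOddPeriodicH2.apply_neg_pi {U V W : ℝ → ℂ} (h : IsOddPeriodicH2 U V W) :
    U (-Real.pi) = 0 := by
  rw [h.odd, h.apply_pi, neg_zero]

theorem IsOddPeriodicH2.continuous {U V W : ℝ → ℂ} (h : IsOddPeriodicH2 U V W) : Continuous U :=
  continuous_iff_continuousAt.2 fun x => (h.hasDerivAt x).continuousAt

theorem IsOddPeriodicH2.intervalIntegrable' {U V W : ℝ → ℂ} (h : IsOddPeriodicH2 U V W)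
    {a b : ℝ} (ha : a ∈ Icc (-Real.pi) Real.pi) (hb : b ∈ Icc (-Real.pi) Real.pi) :
    IntervalIntegrable W volume a b :=
  (h.intervalIntegrable ha).symm.trans (h.intervalIntegrable hb)

theorem IsOddPeriodicH2.eq_integral' {U V W : ℝ → ℂ} (h : IsOddPeriodicH2 U V W)
    {a x : ℝ} (ha : a ∈ Icc (-Real.pi) Real.pi) (hx : x ∈ Icc (-Real.pi) Real.pi) :
    V x = V a + ∫ t in a..x, W t := by
  rw [h.eq_integral x hx, h.eq_integral a ha, add_assoc,
    intervalIntegral.integral_add_adjacent_intervals (h.intervalIntegrable ha)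
      (h.intervalIntegrable' ha hx)]

theorem IsOddPeriodicH2.continuousOn {U V W : ℝ → ℂ} (h : IsOddPeriodicH2 U V W) :
    ContinuousOn V (Icc (-Real.pi) Real.pi) := by
  have hπ := Real.pi_pos
  have hl : -Real.pi ∈ Icc (-Real.pi) Real.pi := ⟨le_rfl, by linarith⟩
  have hr : Real.pi ∈ Icc (-Real.pi) Real.pi := ⟨by linarith, le_rfl⟩
  have := (absolutelyContinuousOnInterval_primitive (h.intervalIntegrable' hl hr)
    left_mem_uIcc).continuousOn
  rw [uIcc_of_le (by linarith)] at this
  exact (continuousOn_const.add this).congr fun x hx => h.eq_integral' hl hx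

/-! ### The weight attached to an equilibrium -/

/-- The weight `s = 1 - α ψ'` attached to an equilibrium: it is positive, even, and satisfies
`s' = 2 ψ s`. -/
structure IsGauge (α : ℝ) (ψ s : ℝ → ℝ) : Prop where
  eq : ∀ x, s x = 1 - α * deriv ψ x
  pos : ∀ x, 0 < s x
  hasDerivAt : ∀ x, HasDerivAt s (2 * ψ x * s x) x
  even : ∀ x, s (-x) = s x
  continuous : Continuous ψ

namespace IsGauge

variable {α : ℝ} {ψ s : ℝ → ℝ}

theorem continuous_s (hs : IsGauge α ψ s) : Continuous s :=
  continuous_iff_continuousAt.2 fun x => (hs.hasDerivAt x).continuousAt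

theorem continuous_ofReal (hs : IsGauge α ψ s) : Continuous fun x => (s x : ℂ) :=
  Complex.continuous_ofReal.comp hs.continuous_s

theorem ne_zero (hs : IsGauge α ψ s) (x : ℝ) : (s x : ℂ) ≠ 0 :=
  Complex.ofReal_ne_zero.2 (hs.pos x).ne'

theorem continuous_inv (hs : IsGauge α ψ s) : Continuous fun x => (s x : ℂ)⁻¹ :=
  hs.continuous_ofReal.inv₀ hs.ne_zero

theorem hasDerivAt_ofReal (hs : IsGauge α ψ s) (x : ℝ) :
    HasDerivAt (fun x => (s x : ℂ)) (2 * ψ x * s x) x := by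
  have := (hs.hasDerivAt x).ofReal_comp
  push_cast at this
  exact this

theorem hasDerivAt_inv (hs : IsGauge α ψ s) (x : ℝ) :
    HasDerivAt (fun x => (s x : ℂ)⁻¹) (-(2 * ψ x * (s x : ℂ)⁻¹)) x := by
  refine ((hs.hasDerivAt_ofReal x).inv (hs.ne_zero x)).congr_deriv ?_
  have := hs.ne_zero x
  field_simp

theorem continuous_psi (hs : IsGauge α ψ s) : Continuous fun x => (ψ x : ℂ) :=
  Complex.continuous_ofReal.comp hs.continuous

end IsGauge

/-! ### The Green operator of `-α s (u' / s)'` -/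

/-- The primitive vanishing at `0` of a function in `L²(-π, π)`. -/
def primitiveLp (f : Lp ℂ 2 muPi) (x : ℝ) : ℂ := ∫ t in (0 : ℝ)..x, f t ∂muPi

theorem integrable_muPi (f : Lp ℂ 2 muPi) : Integrable f muPi := (Lp.memLp f).integrable (by norm_num)

theorem intervalIntegrable_muPi (f : Lp ℂ 2 muPi) (a b : ℝ) : IntervalIntegrable f muPi a b :=
  (integrable_muPi f).intervalIntegrable

theorem primitiveLp_congr {f : Lp ℂ 2 muPi} {g : ℝ → ℂ} (h : f =ᵐ[muPi] g) (x : ℝ) :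
    primitiveLp f x = ∫ t in (0 : ℝ)..x, g t ∂muPi :=
  intervalIntegral.integral_congr_ae (h.mono fun _ ht _ => ht)

theorem primitiveLp_add (f g : Lp ℂ 2 muPi) (x : ℝ) :
    primitiveLp (f + g) x = primitiveLp f x + primitiveLp g x := by
  rw [primitiveLp_congr (Lp.coeFn_add f g)]
  exact intervalIntegral.integral_add (intervalIntegrable_muPi f 0 x) (intervalIntegrable_muPi g 0 x)

theorem primitiveLp_smul (c : ℂ) (f : Lp ℂ 2 muPi) (x : ℝ) :
    primitiveLp (c • f) x = c * primitiveLp f x := by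
  rw [primitiveLp_congr (Lp.coeFn_smul c f)]
  exact intervalIntegral.integral_const_mul _ _

theorem continuous_primitiveLp (f : Lp ℂ 2 muPi) : Continuous (primitiveLp f) :=
  intervalIntegral.continuous_primitive (intervalIntegrable_muPi f) 0

theorem norm_primitiveLp_le (f : Lp ℂ 2 muPi) (x : ℝ) :
    ‖primitiveLp f x‖ ≤ (2 * Real.pi) ^ (1 / 2 : ℝ) * ‖f‖ :=
  norm_intervalIntegral_muPi_le f 0 x

theorem primitiveLp_neg {f : Lp ℂ 2 muPi} (hf : ∀ᵐ x ∂muPi, f (-x) = -f x) {x : ℝ}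
    (hx : x ∈ Icc (-Real.pi) Real.pi) : primitiveLp f (-x) = primitiveLp f x := by
  have hπ := Real.pi_pos
  have h0 : (0 : ℝ) ∈ Icc (-Real.pi) Real.pi := ⟨by linarith, hπ.le⟩
  have hx' : -x ∈ Icc (-Real.pi) Real.pi := ⟨by linarith [hx.2], by linarith [hx.1]⟩
  have h1 := intervalIntegral.integral_comp_neg (a := 0) (b := x) fun t => f t
  rw [neg_zero, intervalIntegral.integral_symm 0 (-x), ← intervalIntegral_muPi h0 hx,
    ← intervalIntegral_muPi h0 hx'] at h1
  rw [primitiveLp, primitiveLp, ← neg_eq_iff_eq_neg.2 h1,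
    ← intervalIntegral.integral_neg]
  exact intervalIntegral.integral_congr_ae (hf.mono fun t ht _ => by rw [ht, neg_neg])

namespace IsGauge

variable {α : ℝ} {ψ s : ℝ → ℝ}

/-- `∫₀ˣ f / s`. -/
def greenF (hs : IsGauge α ψ s) (f : Lp ℂ 2 muPi) (x : ℝ) : ℂ :=
  primitiveLp (mulLp (fun x => (s x : ℂ)⁻¹) hs.continuous_inv f) x

/-- The derivative of the solution `u` of `-α s (u' / s)' = f`. -/
def greenV (hs : IsGauge α ψ s) (f : Lp ℂ 2 muPi) (x : ℝ) : ℂ :=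
  s x * ((∫ t in (-Real.pi)..Real.pi, s t * hs.greenF f t) /
    (α * ∫ t in (-Real.pi)..Real.pi, (s t : ℂ)) - hs.greenF f x / α)

/-- The solution `u` of `-α s (u' / s)' = f`. -/
def greenU (hs : IsGauge α ψ s) (f : Lp ℂ 2 muPi) (x : ℝ) : ℂ :=
  ∫ t in (0 : ℝ)..x, hs.greenV f t

theorem continuous_greenF (hs : IsGauge α ψ s) (f : Lp ℂ 2 muPi) : Continuous (hs.greenF f) :=
  continuous_primitiveLp _

theorem continuous_greenV (hs : IsGauge α ψ s) (f : Lp ℂ 2 muPi) : Continuous (hs.greenV f) :=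
  hs.continuous_ofReal.mul (continuous_const.sub ((hs.continuous_greenF f).div_const _))

theorem continuous_greenU (hs : IsGauge α ψ s) (f : Lp ℂ 2 muPi) : Continuous (hs.greenU f) :=
  intervalIntegral.continuous_primitive (fun a b => (hs.continuous_greenV f).intervalIntegrable a b) 0

theorem greenF_add (hs : IsGauge α ψ s) (f g : Lp ℂ 2 muPi) (x : ℝ) :
    hs.greenF (f + g) x = hs.greenF f x + hs.greenF g x := by
  rw [greenF, map_add, primitiveLp_add]
  rfl

theorem greenF_smul (hs : IsGauge α ψ s) (c : ℂ) (f : Lp ℂ 2 muPi) (x : ℝ) :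
    hs.greenF (c • f) x = c * hs.greenF f x := by
  rw [greenF, map_smul, primitiveLp_smul]
  rfl

theorem greenV_add (hs : IsGauge α ψ s) (f g : Lp ℂ 2 muPi) (x : ℝ) :
    hs.greenV (f + g) x = hs.greenV f x + hs.greenV g x := by
  have e : ∫ t in (-Real.pi)..Real.pi, s t * hs.greenF (f + g) t =
      (∫ t in (-Real.pi)..Real.pi, s t * hs.greenF f t) +
        ∫ t in (-Real.pi)..Real.pi, s t * hs.greenF g t := by
    refine Eq.trans ?_ (intervalIntegral.integral_add
      ((hs.continuous_ofReal.mul (hs.continuous_greenF f)).intervalIntegrable _ _)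
      ((hs.continuous_ofReal.mul (hs.continuous_greenF g)).intervalIntegrable _ _))
    refine intervalIntegral.integral_congr fun t _ => ?_
    simp only [greenF_add]
    ring
  rw [greenV, e, greenF_add, greenV, greenV]
  ring

theorem greenV_smul (hs : IsGauge α ψ s) (c : ℂ) (f : Lp ℂ 2 muPi) (x : ℝ) :
    hs.greenV (c • f) x = c * hs.greenV f x := by
  have e : ∫ t in (-Real.pi)..Real.pi, s t * hs.greenF (c • f) t =
      c * ∫ t in (-Real.pi)..Real.pi, s t * hs.greenF f t := by
    rw [← intervalIntegral.integral_const_mul]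
    refine intervalIntegral.integral_congr fun t _ => ?_
    simp only [greenF_smul]
    ring
  rw [greenV, e, greenF_smul, greenV]
  ring

theorem greenU_add (hs : IsGauge α ψ s) (f g : Lp ℂ 2 muPi) (x : ℝ) :
    hs.greenU (f + g) x = hs.greenU f x + hs.greenU g x := by
  rw [greenU, greenU, greenU, ← intervalIntegral.integral_add
    ((hs.continuous_greenV f).intervalIntegrable _ _) ((hs.continuous_greenV g).intervalIntegrable _ _)]
  exact intervalIntegral.integral_congr fun t _ => hs.greenV_add f g t

theorem greenU_smul (hs : IsGauge α ψ s) (c : ℂ) (f : Lp ℂ 2 muPi) (x : ℝ) :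
    hs.greenU (c • f) x = c * hs.greenU f x := by
  rw [greenU, greenU, ← intervalIntegral.integral_const_mul]
  exact intervalIntegral.integral_congr fun t _ => hs.greenV_smul c f t

theorem exists_norm_greenV_le (hs : IsGauge α ψ s) : ∃ C : ℝ, 0 ≤ C ∧ ∀ f : Lp ℂ 2 muPi,
    ∀ x ∈ Icc (-Real.pi) Real.pi, ‖hs.greenV f x‖ ≤ C * ‖f‖ := by
  have hπ := Real.pi_pos
  obtain ⟨S, hS0, hS⟩ := exists_norm_le_of_continuous hs.continuous_ofReal
  set B : ℝ := (2 * Real.pi) ^ (1 / 2 : ℝ) * ‖mulLp (fun x => (s x : ℂ)⁻¹) hs.continuous_inv‖ with hB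
  have hB0 : 0 ≤ B := by positivity
  have hF : ∀ f x, ‖hs.greenF f x‖ ≤ B * ‖f‖ := by
    intro f x
    refine (norm_primitiveLp_le _ x).trans ?_
    rw [hB, mul_assoc]
    exact mul_le_mul_of_nonneg_left (ContinuousLinearMap.le_opNorm _ _) (by positivity)
  set Z : ℂ := α * ∫ t in (-Real.pi)..Real.pi, (s t : ℂ) with hZ
  refine ⟨S * (S * B * (2 * Real.pi) / ‖Z‖ + B / |α|), by positivity, fun f x hx => ?_⟩
  have h1 : ‖∫ t in (-Real.pi)..Real.pi, s t * hs.greenF f t‖ ≤ (S * (B * ‖f‖)) * (2 * Real.pi) := by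
    refine (intervalIntegral.norm_integral_le_of_norm_le_const (C := S * (B * ‖f‖))
      fun t ht => ?_).trans (le_of_eq ?_)
    · rw [uIoc_of_le (by linarith)] at ht
      rw [norm_mul]
      exact mul_le_mul (hS t (Ioc_subset_Icc_self ht)) (hF f t) (norm_nonneg _) hS0
    · rw [abs_of_pos (by linarith)]
      ring
  rw [greenV, norm_mul, ← hZ, mul_assoc]
  refine mul_le_mul (hS x hx) ?_ (norm_nonneg _) hS0
  refine (norm_sub_le _ _).trans ?_
  rw [norm_div, norm_div, Complex.norm_real, Real.norm_eq_abs]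
  have h2 : ‖∫ t in (-Real.pi)..Real.pi, s t * hs.greenF f t‖ / ‖Z‖ ≤
      (S * (B * ‖f‖)) * (2 * Real.pi) / ‖Z‖ := by gcongr
  have h3 : ‖hs.greenF f x‖ / |α| ≤ B * ‖f‖ / |α| := by
    gcongr
    exact hF f x
  refine (add_le_add h2 h3).trans (le_of_eq ?_)
  ring

/-- The uniform bound on the derivative `greenV` becomes a Lipschitz bound on its primitive. This is
the smoothing from `L²` that makes the Green operator compact. -/
theorem exists_dist_greenU_le (hs : IsGauge α ψ s) : ∃ C : ℝ, 0 ≤ C ∧ ∀ f : Lp ℂ 2 muPi,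
    (∀ x ∈ Icc (-Real.pi) Real.pi, ‖hs.greenU f x‖ ≤ C * ‖f‖) ∧
    ∀ x ∈ Icc (-Real.pi) Real.pi, ∀ y ∈ Icc (-Real.pi) Real.pi,
      dist (hs.greenU f x) (hs.greenU f y) ≤ C * ‖f‖ * dist x y := by
  have hπ := Real.pi_pos
  have h0 : (0 : ℝ) ∈ Icc (-Real.pi) Real.pi := ⟨by linarith, hπ.le⟩
  obtain ⟨C, hC0, hC⟩ := hs.exists_norm_greenV_le
  have hint : ∀ (f : Lp ℂ 2 muPi) (a b : ℝ), IntervalIntegrable (hs.greenV f) volume a b :=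
    fun f a b => (hs.continuous_greenV f).intervalIntegrable a b
  have hd : ∀ f : Lp ℂ 2 muPi, ∀ x ∈ Icc (-Real.pi) Real.pi, ∀ y ∈ Icc (-Real.pi) Real.pi,
      dist (hs.greenU f x) (hs.greenU f y) ≤ C * ‖f‖ * dist x y := by
    intro f x hx y hy
    rw [dist_eq_norm, greenU, greenU, intervalIntegral.integral_interval_sub_left (hint f _ _)
      (hint f _ _), Real.dist_eq]
    refine intervalIntegral.norm_integral_le_of_norm_le_const fun t ht => hC f t ?_
    exact uIcc_subset_Icc hy hx (uIoc_subset_uIcc ht)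
  -- One constant for both bounds: the sup bound needs the factor `π`, the Lipschitz bound the
  -- factor `1`.
  refine ⟨C * (1 + Real.pi), by positivity, fun f => ⟨fun x hx => ?_, fun x hx y hy => ?_⟩⟩
  · have := hd f x hx 0 h0
    have e : hs.greenU f 0 = 0 := intervalIntegral.integral_same
    rw [e, dist_zero_right, dist_zero_right, Real.norm_eq_abs] at this
    refine this.trans ?_
    have hx' : |x| ≤ 1 + Real.pi := by
      have := abs_le.2 ⟨hx.1, hx.2⟩
      linarith
    calc C * ‖f‖ * |x| ≤ C * ‖f‖ * (1 + Real.pi) := by gcongr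
      _ = _ := by ring
  · refine (hd f x hx y hy).trans ?_
    have : C ≤ C * (1 + Real.pi) := by nlinarith
    gcongr

theorem greenV_neg (hs : IsGauge α ψ s) (f : OddL2) {x : ℝ} (hx : x ∈ Icc (-Real.pi) Real.pi) :
    hs.greenV f (-x) = hs.greenV f x := by
  have h : hs.greenF f (-x) = hs.greenF f x := by
    refine primitiveLp_neg ?_ hx
    have h := coeFn_mulLp (fun x => (s x : ℂ)⁻¹) hs.continuous_inv (f : Lp ℂ 2 muPi)
    filter_upwards [h, measurePreserving_neg_muPi.quasiMeasurePreserving.ae h, ae_neg_of_OddL2 f]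
      with x h1 h2 h3
    rw [h1, h2, hs.even, h3]
    ring
  rw [greenV, greenV, h, hs.even]

/-- Integrating `-α (u'/s)' = f/s` gives `u' = s (a - greenF / α)`; the quotient of integrals in
`greenV` is the one value of `a` for which `u` is periodic. -/
theorem integral_greenV (hs : IsGauge α ψ s) (hα : α ≠ 0) (f : Lp ℂ 2 muPi) :
    ∫ t in (-Real.pi)..Real.pi, hs.greenV f t = 0 := by
  have hπ := Real.pi_pos
  have hα' : (α : ℂ) ≠ 0 := Complex.ofReal_ne_zero.2 hα
  have hZ : (∫ t in (-Real.pi)..Real.pi, (s t : ℂ)) ≠ 0 := by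
    rw [intervalIntegral.integral_ofReal, Complex.ofReal_ne_zero]
    exact (intervalIntegral.intervalIntegral_pos_of_pos_on
      (hs.continuous_s.intervalIntegrable _ _) (fun x _ => hs.pos x) (by linarith)).ne'
  simp only [greenV, mul_sub]
  rw [intervalIntegral.integral_sub]
  · have e : ∀ t, (s t : ℂ) * (hs.greenF f t / α) = (s t * hs.greenF f t) / α := fun t => by ring
    simp only [e]
    rw [intervalIntegral.integral_mul_const, intervalIntegral.integral_div]
    field_simp
    ring
  · exact (hs.continuous_ofReal.mul continuous_const).intervalIntegrable _ _
  · exact (hs.continuous_ofReal.mul ((hs.continuous_greenF f).div_const _)).intervalIntegrable _ _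

theorem memLp_greenU (hs : IsGauge α ψ s) (f : Lp ℂ 2 muPi) : MemLp (hs.greenU f) 2 muPi :=
  memLp_of_continuous (hs.continuous_greenU f) 2

theorem greenU_neg (hs : IsGauge α ψ s) (f : OddL2) {x : ℝ} (hx : x ∈ Icc (-Real.pi) Real.pi) :
    hs.greenU f (-x) = -hs.greenU f x := by
  have hπ := Real.pi_pos
  have h1 := intervalIntegral.integral_comp_neg (a := 0) (b := x) (hs.greenV f)
  rw [neg_zero, intervalIntegral.integral_symm 0 (-x)] at h1
  rw [greenU, ← neg_eq_iff_eq_neg, ← h1]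
  exact intervalIntegral.integral_congr fun t ht =>
    hs.greenV_neg f (uIcc_subset_Icc ⟨by linarith, hπ.le⟩ hx ht)

theorem toLp_greenU_mem (hs : IsGauge α ψ s) (f : OddL2) :
    (hs.memLp_greenU f).toLp (hs.greenU f) ∈ OddL2 := by
  change ∀ᵐ x ∂muPi, (hs.memLp_greenU f).toLp (hs.greenU f) (-x) =
    -(hs.memLp_greenU f).toLp (hs.greenU f) x
  have h := (hs.memLp_greenU f).coeFn_toLp
  filter_upwards [h, measurePreserving_neg_muPi.quasiMeasurePreserving.ae h,
    ae_restrict_mem measurableSet_Ioo] with x h1 h2 hx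
  rw [h1, h2, hs.greenU_neg f (Ioo_subset_Icc_self hx)]

/-- The Green operator as a linear map. -/
def greenLinear (hs : IsGauge α ψ s) : OddL2 →ₗ[ℂ] OddL2 where
  toFun f := ⟨(hs.memLp_greenU f).toLp (hs.greenU f), hs.toLp_greenU_mem f⟩
  map_add' f g := by
    exact Subtype.ext ((MemLp.toLp_congr (hs.memLp_greenU (f + g : OddL2)) ((hs.memLp_greenU f).add (hs.memLp_greenU g))
      (Filter.Eventually.of_forall fun x => hs.greenU_add f g x)).trans (MemLp.toLp_add (hs.memLp_greenU f) (hs.memLp_greenU g)))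
  map_smul' c f := by
    exact Subtype.ext ((MemLp.toLp_congr (hs.memLp_greenU (c • f : OddL2)) ((hs.memLp_greenU f).const_smul c)
      (Filter.Eventually.of_forall fun x => hs.greenU_smul c f x)).trans
        (MemLp.toLp_const_smul c (hs.memLp_greenU f)))

theorem coeFn_greenLinear (hs : IsGauge α ψ s) (f : OddL2) :
    (hs.greenLinear f : Lp ℂ 2 muPi) =ᵐ[muPi] hs.greenU f :=
  (hs.memLp_greenU f).coeFn_toLp

/-- The image of the unit ball consists of uniformly bounded, equi-Lipschitz functions. Continuity
of the operator is then deduced from compactness. -/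
theorem isCompactOperator_greenLinear (hs : IsGauge α ψ s) : IsCompactOperator hs.greenLinear := by
  obtain ⟨C, hC0, hC⟩ := hs.exists_dist_greenU_le
  obtain ⟨K, hK, hK'⟩ := exists_isCompact_lipschitz C
  refine ⟨Subtype.val ⁻¹' K, isClosed_OddL2.isClosedEmbedding_subtypeVal.isCompact_preimage hK, ?_⟩
  refine Filter.mem_of_superset (Metric.closedBall_mem_nhds 0 one_pos) fun f hf => ?_
  have hf1 : ‖(f : Lp ℂ 2 muPi)‖ ≤ 1 := by simpa using hf
  have hCf : C * ‖(f : Lp ℂ 2 muPi)‖ ≤ C := mul_le_of_le_one_right hC0 hf1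
  refine hK' _ _ (hs.coeFn_greenLinear f) (fun x hx => ((hC f).1 x hx).trans hCf)
    fun x hx y hy => ((hC f).2 x hx y hy).trans ?_
  gcongr

/-- The Green operator: `green f` is the solution of `-α s (u' / s)' = f`. -/
def green (hs : IsGauge α ψ s) : OddL2 →L[ℂ] OddL2 :=
  ⟨hs.greenLinear, hs.isCompactOperator_greenLinear.continuous⟩

theorem isCompactOperator_green (hs : IsGauge α ψ s) : IsCompactOperator hs.green :=
  hs.isCompactOperator_greenLinear

theorem coeFn_green (hs : IsGauge α ψ s) (f : OddL2) :
    (hs.green f : Lp ℂ 2 muPi) =ᵐ[muPi] hs.greenU f :=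
  hs.coeFn_greenLinear f

end IsGauge

/-! ### The linearized operator and its resolvent -/

theorem intervalIntegrable_of_Lp (f : Lp ℂ 2 muPi) {a b : ℝ} (ha : a ∈ Icc (-Real.pi) Real.pi)
    (hb : b ∈ Icc (-Real.pi) Real.pi) : IntervalIntegrable f volume a b := by
  have h1 : IntegrableOn f (Ioo (-Real.pi) Real.pi) volume := integrable_muPi f
  have h2 : IntegrableOn f (Icc (-Real.pi) Real.pi) volume :=
    (integrableOn_Icc_iff_integrableOn_Ioo).2 h1
  exact (h2.mono_set (uIcc_subset_Icc ha hb)).intervalIntegrable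

theorem zero_mem_Icc_pi : (0 : ℝ) ∈ Icc (-Real.pi) Real.pi :=
  ⟨by linarith [Real.pi_pos], Real.pi_pos.le⟩

theorem pi_mem_Icc_pi : Real.pi ∈ Icc (-Real.pi) Real.pi := ⟨by linarith [Real.pi_pos], le_rfl⟩

theorem neg_pi_mem_Icc_pi : -Real.pi ∈ Icc (-Real.pi) Real.pi := ⟨le_rfl, by linarith [Real.pi_pos]⟩

theorem ae_muPi_mem_Icc : ∀ᵐ x ∂muPi, x ∈ Icc (-Real.pi) Real.pi :=
  (ae_restrict_mem measurableSet_Ioo).mono fun _ hx => Ioo_subset_Icc_self hx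

namespace IsGauge

variable {α : ℝ} {ψ s : ℝ → ℝ}

theorem linExpr_eq (hs : IsGauge α ψ s) (U V W : ℝ → ℂ) (x : ℝ) :
    linExpr α ψ U V W x = -(α : ℂ) * W x + 2 * (α : ℂ) * (ψ x : ℂ) * V x - 2 * s x * U x := by
  rw [linExpr, hs.eq]
  push_cast
  ring

/-- Multiplication by `s` in `OddL2`. -/
def mulS (hs : IsGauge α ψ s) : OddL2 →L[ℂ] OddL2 :=
  mulOdd (fun x => (s x : ℂ)) hs.continuous_ofReal fun x => by rw [hs.even]

/-- Multiplication by `1 / s` in `OddL2`. -/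
def mulInv (hs : IsGauge α ψ s) : OddL2 →L[ℂ] OddL2 :=
  mulOdd (fun x => (s x : ℂ)⁻¹) hs.continuous_inv fun x => by rw [hs.even]

theorem coeFn_mulS (hs : IsGauge α ψ s) (f : OddL2) :
    (hs.mulS f : Lp ℂ 2 muPi) =ᵐ[muPi] fun x => s x * (f : Lp ℂ 2 muPi) x :=
  coeFn_mulOdd _ _ _ f

theorem coeFn_mulInv (hs : IsGauge α ψ s) (f : OddL2) :
    (hs.mulInv f : Lp ℂ 2 muPi) =ᵐ[muPi] fun x => (s x : ℂ)⁻¹ * (f : Lp ℂ 2 muPi) x :=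
  coeFn_mulOdd _ _ _ f

theorem greenF_congr (hs : IsGauge α ψ s) {f : Lp ℂ 2 muPi} {g : ℝ → ℂ} (h : f =ᵐ[muPi] g) {x : ℝ}
    (hx : x ∈ Icc (-Real.pi) Real.pi) :
    hs.greenF f x = ∫ t in (0 : ℝ)..x, (s t : ℂ)⁻¹ * g t := by
  rw [greenF, ← intervalIntegral_muPi zero_mem_Icc_pi hx]
  refine primitiveLp_congr ?_ x
  filter_upwards [coeFn_mulLp (fun x => (s x : ℂ)⁻¹) hs.continuous_inv f, h] with t h1 h2
  rw [h1, h2]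

/-- The Green operator is a right inverse of `A = L + 2 s`. Together with `green_of_mem_linGraph`
this identifies the domain of `L` with its range. -/
theorem green_mem_linGraph (hs : IsGauge α ψ s) (hα : α ≠ 0) (f : OddL2) :
    (hs.green f, f - (2 : ℂ) • hs.mulS (hs.green f)) ∈ linGraph α ψ := by
  have hα' : (α : ℂ) ≠ 0 := Complex.ofReal_ne_zero.2 hα
  set F : Lp ℂ 2 muPi := (f : Lp ℂ 2 muPi) with hF
  set a : ℂ := (∫ t in (-Real.pi)..Real.pi, s t * hs.greenF F t) /
    (α * ∫ t in (-Real.pi)..Real.pi, (s t : ℂ)) with ha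
  -- This is the second derivative of `u`, read off from `u' = s (a - greenF / α)` and `s' = 2 ψ s`.
  have hW : MemLp (fun x => 2 * (ψ x : ℂ) * hs.greenV F x + (-(α : ℂ)⁻¹) * F x) 2 muPi :=
    (memLp_of_continuous ((continuous_const.mul hs.continuous_psi).mul (hs.continuous_greenV F)) 2).add
      ((Lp.memLp F).const_mul _)
  have hvW : ∀ x ∈ Icc (-Real.pi) Real.pi, hs.greenV F x = hs.greenV F 0 +
      ∫ t in (0 : ℝ)..x, (2 * (ψ t : ℂ) * hs.greenV F t + (-(α : ℂ)⁻¹) * F t) := by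
    intro x hx
    have hsub : uIcc 0 x ⊆ Icc (-Real.pi) Real.pi := uIcc_subset_Icc zero_mem_Icc_pi hx
    have hFi : IntervalIntegrable (fun t => -(α : ℂ)⁻¹ * ((s t : ℂ)⁻¹ * F t)) volume 0 x :=
      ((intervalIntegrable_of_Lp F zero_mem_Icc_pi hx).continuousOn_mul
        hs.continuous_inv.continuousOn).const_mul _
    have key := integral_deriv_mul_primitive (p := fun x => (s x : ℂ))
      (H := fun x => a - hs.greenF F x / α) (a := 0) (b := x)
      (fun t _ => hs.hasDerivAt_ofReal t)
      ((continuous_const.mul hs.continuous_psi).mul hs.continuous_ofReal).continuousOn hFi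
      (fun t ht => by
        rw [hs.greenF_congr (Filter.EventuallyEq.refl _ F) (hsub ht),
          hs.greenF_congr (Filter.EventuallyEq.refl _ F) zero_mem_Icc_pi,
          intervalIntegral.integral_same, intervalIntegral.integral_const_mul]
        field_simp
        ring)
    have e1 : hs.greenV F x = s x * (a - hs.greenF F x / α) := rfl
    have e2 : hs.greenV F 0 = s 0 * (a - hs.greenF F 0 / α) := rfl
    rw [e1, e2, ← sub_eq_iff_eq_add', ← key]
    refine intervalIntegral.integral_congr fun t _ => ?_
    have e3 : hs.greenV F t = s t * (a - hs.greenF F t / α) := rfl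
    have := hs.ne_zero t
    simp only [e3]
    field_simp
  obtain ⟨U, V, hU, hUV⟩ := exists_isOddPeriodicH2 (hs.continuous_greenV F)
    (fun x hx => hs.greenV_neg f hx) (hs.integral_greenV hα F) hW hvW
  refine ⟨U, V, _, hU, ?_, ?_⟩
  · filter_upwards [hs.coeFn_green f, ae_muPi_mem_Icc] with x h1 hx
    rw [h1, (hUV x hx).2]
    rfl
  · have h1 := Lp.coeFn_sub F ((2 : ℂ) • (hs.mulS (hs.green f) : Lp ℂ 2 muPi))
    have h2 := Lp.coeFn_smul (2 : ℂ) (hs.mulS (hs.green f) : Lp ℂ 2 muPi)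
    filter_upwards [h1, h2, hs.coeFn_mulS (hs.green f), hs.coeFn_green f, ae_muPi_mem_Icc]
      with x h1 h2 h3 h4 hx
    refine h1.trans ?_
    rw [Pi.sub_apply, h2, Pi.smul_apply, h3, h4, hs.linExpr_eq, (hUV x hx).1, (hUV x hx).2]
    simp only [greenU, smul_eq_mul]
    field_simp
    ring

/-- For `u` of class `H²`, the quotient `u' / s` is a primitive of `-(L u / s + 2 u) / α`. -/
theorem inv_mul_eq_integral (hs : IsGauge α ψ s) (hα : α ≠ 0) {U V W : ℝ → ℂ}
    (h : IsOddPeriodicH2 U V W) {a x : ℝ} (ha : a ∈ Icc (-Real.pi) Real.pi)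
    (hx : x ∈ Icc (-Real.pi) Real.pi) : (s x : ℂ)⁻¹ * V x = (s a : ℂ)⁻¹ * V a +
      ∫ t in a..x, -(α : ℂ)⁻¹ * ((s t : ℂ)⁻¹ * linExpr α ψ U V W t + 2 * U t) := by
  have hα' : (α : ℂ) ≠ 0 := Complex.ofReal_ne_zero.2 hα
  have key := integral_deriv_mul_primitive (p := fun x => (s x : ℂ)⁻¹) (H := V) (a := a) (b := x)
    (fun t _ => hs.hasDerivAt_inv t)
    ((continuous_const.mul hs.continuous_psi).mul hs.continuous_inv).neg.continuousOn
    (h.intervalIntegrable' ha hx) fun t ht => h.eq_integral' ha (uIcc_subset_Icc ha hx ht)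
  rw [← sub_eq_iff_eq_add', ← key]
  refine intervalIntegral.integral_congr fun t _ => ?_
  have := hs.ne_zero t
  simp only [hs.linExpr_eq]
  field_simp
  ring

theorem intervalIntegrable_linExpr (hs : IsGauge α ψ s) {U V W : ℝ → ℂ} (h : IsOddPeriodicH2 U V W) :
    IntervalIntegrable (linExpr α ψ U V W) volume (-Real.pi) Real.pi := by
  have hπ := Real.pi_pos
  have e : linExpr α ψ U V W = fun x => (-(α : ℂ) * W x + 2 * (α : ℂ) * (ψ x : ℂ) * V x)
      - 2 * s x * U x := funext (hs.linExpr_eq U V W)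
  have hV : ContinuousOn V (uIcc (-Real.pi) Real.pi) := by
    rw [uIcc_of_le (by linarith)]
    exact h.continuousOn
  rw [e]
  exact (((h.intervalIntegrable' neg_pi_mem_Icc_pi pi_mem_Icc_pi).const_mul _).add
    (((continuous_const.mul hs.continuous_psi).continuousOn.mul hV).intervalIntegrable)).sub
    (((continuous_const.mul hs.continuous_ofReal).mul h.continuous).intervalIntegrable _ _)

/-- The Green operator is also a left inverse of `A`: integrating once determines `u'/s` up to its
value at `0`, and that value is forced because `u'` has mean zero. -/
theorem green_of_mem_linGraph (hs : IsGauge α ψ s) (hα : α ≠ 0) {u g : OddL2}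
    (h : (u, g) ∈ linGraph α ψ) : hs.green (g + (2 : ℂ) • hs.mulS u) = u := by
  have hα' : (α : ℂ) ≠ 0 := Complex.ofReal_ne_zero.2 hα
  have hπ := Real.pi_pos
  obtain ⟨U, V, W, hU, hu, hg⟩ := h
  simp only at hu hg
  set f : OddL2 := g + (2 : ℂ) • hs.mulS u with hf
  have hfe : (f : Lp ℂ 2 muPi) =ᵐ[muPi] fun x => linExpr α ψ U V W x + 2 * s x * U x := by
    have h1 := Lp.coeFn_add (g : Lp ℂ 2 muPi) ((2 : ℂ) • (hs.mulS u : Lp ℂ 2 muPi))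
    have h2 := Lp.coeFn_smul (2 : ℂ) (hs.mulS u : Lp ℂ 2 muPi)
    filter_upwards [h1, h2, hs.coeFn_mulS u, hu, hg] with x h1 h2 h3 h4 h5
    refine h1.trans ?_
    rw [Pi.add_apply, h2, Pi.smul_apply, h3, h4, h5, smul_eq_mul]
    ring
  have hV : ∀ x ∈ Icc (-Real.pi) Real.pi,
      V x = s x * ((s 0 : ℂ)⁻¹ * V 0 - hs.greenF f x / α) := by
    intro x hx
    have h1 := hs.inv_mul_eq_integral hα hU zero_mem_Icc_pi hx
    rw [intervalIntegral.integral_const_mul] at h1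
    have h2 : hs.greenF f x =
        ∫ t in (0 : ℝ)..x, ((s t : ℂ)⁻¹ * linExpr α ψ U V W t + 2 * U t) := by
      rw [hs.greenF_congr hfe hx]
      refine intervalIntegral.integral_congr fun t _ => ?_
      have := hs.ne_zero t
      field_simp
    rw [← h2] at h1
    have := hs.ne_zero x
    have h3 : V x = s x * ((s x : ℂ)⁻¹ * V x) := by field_simp
    rw [h3, h1]
    ring
  have hVi : IntervalIntegrable V volume (-Real.pi) Real.pi := by
    refine ContinuousOn.intervalIntegrable ?_
    rw [uIcc_of_le (by linarith)]
    exact hU.continuousOn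
  have hZ : (∫ t in (-Real.pi)..Real.pi, (s t : ℂ)) ≠ 0 := by
    rw [intervalIntegral.integral_ofReal, Complex.ofReal_ne_zero]
    exact (intervalIntegral.intervalIntegral_pos_of_pos_on
      (hs.continuous_s.intervalIntegrable _ _) (fun x _ => hs.pos x) (by linarith)).ne'
  have hmean : ∫ t in (-Real.pi)..Real.pi, V t = 0 := by
    rw [intervalIntegral.integral_eq_sub_of_hasDerivAt (fun x _ => hU.hasDerivAt x) hVi,
      hU.apply_pi, hU.apply_neg_pi, sub_zero]
  have ha : (s 0 : ℂ)⁻¹ * V 0 = (∫ t in (-Real.pi)..Real.pi, s t * hs.greenF f t) /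
      (α * ∫ t in (-Real.pi)..Real.pi, (s t : ℂ)) := by
    have h1 : ∫ t in (-Real.pi)..Real.pi, V t = ∫ t in (-Real.pi)..Real.pi,
        ((s t : ℂ) * ((s 0 : ℂ)⁻¹ * V 0) - (s t * hs.greenF f t) / α) := by
      refine intervalIntegral.integral_congr fun t ht => ?_
      rw [uIcc_of_le (by linarith)] at ht
      rw [hV t ht]
      ring
    have i1 : IntervalIntegrable (fun t => (s t : ℂ) * ((s 0 : ℂ)⁻¹ * V 0)) volume
        (-Real.pi) Real.pi :=
      (hs.continuous_ofReal.mul continuous_const).intervalIntegrable _ _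
    have i2 : IntervalIntegrable (fun t => (s t * hs.greenF f t) / (α : ℂ)) volume
        (-Real.pi) Real.pi :=
      ((hs.continuous_ofReal.mul (hs.continuous_greenF f)).div_const _).intervalIntegrable _ _
    rw [hmean, intervalIntegral.integral_sub i1 i2,
      intervalIntegral.integral_mul_const, intervalIntegral.integral_div] at h1
    rw [eq_div_iff (mul_ne_zero hα' hZ)]
    have h2 := (sub_eq_zero.1 h1.symm)
    rw [eq_div_iff hα'] at h2
    rw [← h2]
    ring
  refine OddL2_ext ?_
  filter_upwards [hs.coeFn_green f, hu, ae_muPi_mem_Icc] with x h1 h2 hx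
  rw [h1, h2, greenU]
  have hsub : uIcc 0 x ⊆ Icc (-Real.pi) Real.pi := uIcc_subset_Icc zero_mem_Icc_pi hx
  have h3 : ∫ t in (0 : ℝ)..x, V t = U x := by
    rw [intervalIntegral.integral_eq_sub_of_hasDerivAt (fun x _ => hU.hasDerivAt x)
      (hU.continuousOn.mono hsub).intervalIntegrable, hU.apply_zero, sub_zero]
  rw [← h3]
  refine intervalIntegral.integral_congr fun t ht => ?_
  rw [hV t (hsub ht), ha]
  rfl

end IsGauge

theorem mem_linGraph_iff {α : ℝ} {ψ : ℝ → ℝ} {u g : OddL2} :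
    (u, g) ∈ linGraph α ψ ↔ ∃ hu : u ∈ (linOp α ψ).domain, linOp α ψ ⟨u, hu⟩ = g := by
  rw [← linOp_graph, LinearPMap.mem_graph_iff]
  constructor
  · rintro ⟨⟨y, hy⟩, rfl, h2⟩
    exact ⟨hy, h2⟩
  · rintro ⟨hu, h⟩
    exact ⟨⟨u, hu⟩, rfl, h⟩

theorem isUnboundedEigenvalue_linOp_iff {α : ℝ} {ψ : ℝ → ℝ} {z : ℂ} :
    IsUnboundedEigenvalue (linOp α ψ) z ↔ ∃ u : OddL2, u ≠ 0 ∧ (u, z • u) ∈ linGraph α ψ := by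
  constructor
  · rintro ⟨u, hu, h⟩
    exact ⟨u, hu, mem_linGraph_iff.2 ⟨u.2, h⟩⟩
  · rintro ⟨u, hu, h⟩
    obtain ⟨hd, h⟩ := mem_linGraph_iff.1 h
    exact ⟨⟨u, hd⟩, hu, h⟩

theorem IsUnboundedEigenvalue.mem_unboundedSpectrum {E : Type*} [NormedAddCommGroup E]
    [NormedSpace ℂ E] {T : E →ₗ.[ℂ] E} {z : ℂ} (h : IsUnboundedEigenvalue T z) :
    z ∈ unboundedSpectrum T := by
  obtain ⟨u, hu, h⟩ := h
  rintro ⟨R, -, hR⟩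
  have := hR u
  rw [h, sub_self, map_zero] at this
  exact hu this.symm

namespace IsGauge

variable {α : ℝ} {ψ s : ℝ → ℝ}

/-- The compact operator `T` such that `L - z = (1 - T) A`, with `A` the inverse of the Green
operator. -/
def fredholmOp (hs : IsGauge α ψ s) (z : ℂ) : OddL2 →L[ℂ] OddL2 :=
  ((2 : ℂ) • hs.mulS + z • ContinuousLinearMap.id ℂ OddL2).comp hs.green

theorem fredholmOp_apply (hs : IsGauge α ψ s) (z : ℂ) (f : OddL2) :
    hs.fredholmOp z f = (2 : ℂ) • hs.mulS (hs.green f) + z • hs.green f := rfl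

/-- Fredholm alternative: were `1` an eigenvalue of `T` with eigenvector `f`, then `green f` would
be an eigenfunction of `L` for `z`, because `L (green f) = f - 2 s green f`. -/
theorem isUnit_one_sub_fredholmOp (hs : IsGauge α ψ s) (hα : α ≠ 0) {z : ℂ}
    (hz : ¬ IsUnboundedEigenvalue (linOp α ψ) z) : IsUnit (1 - hs.fredholmOp z) := by
  have hc : IsCompactOperator (hs.fredholmOp z) :=
    hs.isCompactOperator_green.clm_comp
      ((2 : ℂ) • hs.mulS + z • ContinuousLinearMap.id ℂ OddL2)
  rcases hc.hasEigenvalue_or_mem_resolventSet one_ne_zero with h | h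
  · exfalso
    obtain ⟨f, hf⟩ := h.exists_hasEigenvector
    have hf1 : hs.fredholmOp z f = f := by simpa using hf.apply_eq_smul
    rw [fredholmOp_apply] at hf1
    -- `green f = 0` would give `f = T f = 0`, as `T` factors through `green`.
    refine hz (isUnboundedEigenvalue_linOp_iff.2 ⟨hs.green f, fun h0 => hf.2 ?_, ?_⟩)
    · rw [← hf1, h0]
      simp
    · have h1 := hs.green_mem_linGraph hα f
      convert h1 using 2
      rw [eq_sub_iff_add_eq, add_comm]
      exact hf1
  · rw [spectrum.mem_resolventSet_iff, map_one] at h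
    exact h

/-- The spectrum of the linearized operator consists of eigenvalues. -/
theorem isUnboundedEigenvalue_of_mem_unboundedSpectrum (hs : IsGauge α ψ s) (hα : α ≠ 0) {z : ℂ}
    (hz : z ∈ unboundedSpectrum (linOp α ψ)) : IsUnboundedEigenvalue (linOp α ψ) z := by
  by_contra hne
  obtain ⟨Q, hQ⟩ := hs.isUnit_one_sub_fredholmOp hα hne
  -- The resolvent is `A⁻¹ (1 - T)⁻¹`, since `L - z = (1 - T) A`.
  refine hz ⟨hs.green.comp (Q⁻¹ : (OddL2 →L[ℂ] OddL2)ˣ).val, fun f => ?_, fun u => ?_⟩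
  · set g := (Q⁻¹ : (OddL2 →L[ℂ] OddL2)ˣ).val f with hg
    have h1 : (1 - hs.fredholmOp z) g = f := by
      rw [hg, ← hQ, ← mul_apply_eq_comp, Units.mul_inv, one_apply_eq_self]
    obtain ⟨hd, h⟩ := mem_linGraph_iff.1 (hs.green_mem_linGraph hα g)
    refine ⟨hd, ?_⟩
    change linOp α ψ ⟨hs.green g, hd⟩ - z • hs.green g = f
    rw [h, ← h1, sub_apply, one_apply_eq_self, fredholmOp_apply,
      sub_sub]
  · have h1 := hs.green_of_mem_linGraph hα (mem_linGraph_iff.2 ⟨u.2, rfl⟩)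
    set g := linOp α ψ u + (2 : ℂ) • hs.mulS u with hg
    have h1 : hs.green g = u := h1
    have h2 : linOp α ψ u - z • (u : OddL2) = Q.val g := by
      rw [hQ, sub_apply, one_apply_eq_self, fredholmOp_apply, h1, hg]
      abel
    have h3 : (Q⁻¹ : (OddL2 →L[ℂ] OddL2)ˣ).val (Q.val g) = g := by
      rw [← mul_apply_eq_comp, Units.inv_mul, one_apply_eq_self]
    rw [h2, ContinuousLinearMap.comp_apply, h3, h1]

end IsGauge

/-! ### Symmetry of the linearized operator in the weighted inner product -/

theorem inner_OddL2 (f g : OddL2) {F G : ℝ → ℂ} (hf : (f : Lp ℂ 2 muPi) =ᵐ[muPi] F)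
    (hg : (g : Lp ℂ 2 muPi) =ᵐ[muPi] G) :
    inner ℂ f g = ∫ x in (-Real.pi)..Real.pi, (starRingEnd ℂ) (F x) * G x := by
  rw [Submodule.coe_inner, L2.inner_def, ← intervalIntegral_muPi neg_pi_mem_Icc_pi pi_mem_Icc_pi,
    intervalIntegral.integral_of_le (by linarith [Real.pi_pos]),
    Measure.restrict_restrict measurableSet_Ioc, inter_eq_right.2 Ioo_subset_Ioc_self]
  refine integral_congr_ae ?_
  filter_upwards [hf, hg] with x h1 h2
  rw [h1, h2, RCLike.inner_apply, mul_comm]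

theorem mulOdd_mulOdd {m m' : ℝ → ℂ} (hm : Continuous m) (he : ∀ x, m (-x) = m x)
    (hm' : Continuous m') (he' : ∀ x, m' (-x) = m' x) (f : OddL2) {n : ℝ → ℂ} (hn : Continuous n)
    (hen : ∀ x, n (-x) = n x) (h : ∀ x, m x * m' x = n x) :
    mulOdd m hm he (mulOdd m' hm' he' f) = mulOdd n hn hen f := by
  refine OddL2_ext ?_
  filter_upwards [coeFn_mulOdd m hm he (mulOdd m' hm' he' f), coeFn_mulOdd m' hm' he' f,
    coeFn_mulOdd n hn hen f] with x h1 h2 h3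
  rw [h1, h2, h3, ← h, mul_assoc]

theorem mulOdd_eq_self {m : ℝ → ℂ} (hm : Continuous m) (he : ∀ x, m (-x) = m x)
    (h : ∀ x, m x = 1) (f : OddL2) : mulOdd m hm he f = f := by
  refine OddL2_ext ?_
  filter_upwards [coeFn_mulOdd m hm he f] with x h1
  rw [h1, h, one_mul]

theorem inner_mulOdd {m : ℝ → ℂ} (hm : Continuous m) (he : ∀ x, m (-x) = m x)
    (hr : ∀ x, (starRingEnd ℂ) (m x) = m x) (f g : OddL2) :
    inner ℂ (mulOdd m hm he f) g = inner ℂ f (mulOdd m hm he g) := by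
  rw [inner_OddL2 _ _ (coeFn_mulOdd m hm he f) (Filter.EventuallyEq.refl _ _),
    inner_OddL2 _ _ (Filter.EventuallyEq.refl _ _) (coeFn_mulOdd m hm he g)]
  refine intervalIntegral.integral_congr fun x _ => ?_
  simp only [map_mul, hr]
  ring

namespace IsGauge

variable {α : ℝ} {ψ s : ℝ → ℝ}

theorem continuous_sqrt (hs : IsGauge α ψ s) : Continuous fun x => (Real.sqrt (s x) : ℂ) :=
  Complex.continuous_ofReal.comp hs.continuous_s.sqrt

theorem sqrt_ne_zero (hs : IsGauge α ψ s) (x : ℝ) : (Real.sqrt (s x) : ℂ) ≠ 0 :=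
  Complex.ofReal_ne_zero.2 (Real.sqrt_pos.2 (hs.pos x)).ne'

theorem sqrt_mul_sqrt (hs : IsGauge α ψ s) (x : ℝ) :
    (Real.sqrt (s x) : ℂ) * (Real.sqrt (s x) : ℂ) = s x := by
  rw [← Complex.ofReal_mul, Real.mul_self_sqrt (hs.pos x).le]

theorem continuous_sqrt_inv (hs : IsGauge α ψ s) : Continuous fun x => (Real.sqrt (s x) : ℂ)⁻¹ :=
  hs.continuous_sqrt.inv₀ hs.sqrt_ne_zero

/-- Multiplication by `√s`. -/
def mulSqrt (hs : IsGauge α ψ s) : OddL2 →L[ℂ] OddL2 :=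
  mulOdd (fun x => (Real.sqrt (s x) : ℂ)) hs.continuous_sqrt fun x => by rw [hs.even]

/-- Multiplication by `1 / √s`. -/
def mulSqrtInv (hs : IsGauge α ψ s) : OddL2 →L[ℂ] OddL2 :=
  mulOdd (fun x => (Real.sqrt (s x) : ℂ)⁻¹) hs.continuous_sqrt_inv fun x => by rw [hs.even]

theorem mulSqrt_mulSqrtInv (hs : IsGauge α ψ s) (f : OddL2) : hs.mulSqrt (hs.mulSqrtInv f) = f :=
  (mulOdd_mulOdd _ _ _ _ f continuous_const (fun _ => rfl)
    fun x => mul_inv_cancel₀ (hs.sqrt_ne_zero x)).trans (mulOdd_eq_self _ _ (fun _ => rfl) f)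

theorem mulSqrtInv_mulSqrt (hs : IsGauge α ψ s) (f : OddL2) : hs.mulSqrtInv (hs.mulSqrt f) = f :=
  (mulOdd_mulOdd _ _ _ _ f continuous_const (fun _ => rfl)
    fun x => inv_mul_cancel₀ (hs.sqrt_ne_zero x)).trans (mulOdd_eq_self _ _ (fun _ => rfl) f)

theorem mulSqrtInv_mulSqrtInv (hs : IsGauge α ψ s) (f : OddL2) :
    hs.mulSqrtInv (hs.mulSqrtInv f) = hs.mulInv f :=
  mulOdd_mulOdd _ _ _ _ f _ _ fun x => by rw [← mul_inv, hs.sqrt_mul_sqrt]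

theorem inner_mulSqrtInv (hs : IsGauge α ψ s) (f g : OddL2) :
    inner ℂ (hs.mulSqrtInv f) g = inner ℂ f (hs.mulSqrtInv g) :=
  inner_mulOdd _ _ (fun x => by rw [map_inv₀, Complex.conj_ofReal]) f g

theorem inner_mulInv (hs : IsGauge α ψ s) (f g : OddL2) :
    inner ℂ f (hs.mulInv g) = inner ℂ (hs.mulSqrtInv f) (hs.mulSqrtInv g) := by
  rw [hs.inner_mulSqrtInv, hs.mulSqrtInv_mulSqrtInv]

theorem mulSqrtInv_ne_zero (hs : IsGauge α ψ s) {f : OddL2} (hf : f ≠ 0) : hs.mulSqrtInv f ≠ 0 := by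
  intro h
  apply hf
  rw [← hs.mulSqrt_mulSqrtInv f, h, map_zero]

/-- Integration by parts in the weighted inner product. -/
theorem integral_conj_mul_linExpr (hs : IsGauge α ψ s) (hα : α ≠ 0) {U V W U' V' W' : ℝ → ℂ}
    (h : IsOddPeriodicH2 U V W) (h' : IsOddPeriodicH2 U' V' W') :
    ∫ x in (-Real.pi)..Real.pi, (starRingEnd ℂ) (U' x) * ((s x : ℂ)⁻¹ * linExpr α ψ U V W x) =
      ∫ x in (-Real.pi)..Real.pi, (α * ((starRingEnd ℂ) (V' x) * ((s x : ℂ)⁻¹ * V x))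
        - 2 * ((starRingEnd ℂ) (U' x) * U x)) := by
  have hα' : (α : ℂ) ≠ 0 := Complex.ofReal_ne_zero.2 hα
  have hπ := Real.pi_pos
  have hIcc : uIcc (-Real.pi) Real.pi = Icc (-Real.pi) Real.pi := uIcc_of_le (by linarith)
  have hcU : Continuous fun x => (starRingEnd ℂ) (U' x) := Complex.continuous_conj.comp h'.continuous
  have hcV : ContinuousOn (fun x => (starRingEnd ℂ) (V' x)) (uIcc (-Real.pi) Real.pi) := by
    rw [hIcc]
    exact Complex.continuous_conj.comp_continuousOn h'.continuousOn
  have hVc : ContinuousOn V (uIcc (-Real.pi) Real.pi) := by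
    rw [hIcc]
    exact h.continuousOn
  have hL := hs.intervalIntegrable_linExpr h
  have hk : IntervalIntegrable (fun t => -(α : ℂ)⁻¹ * ((s t : ℂ)⁻¹ * linExpr α ψ U V W t + 2 * U t))
      volume (-Real.pi) Real.pi :=
    ((hL.continuousOn_mul hs.continuous_inv.continuousOn).add
      ((continuous_const.mul h.continuous).intervalIntegrable _ _)).const_mul _
  have key := integral_deriv_mul_primitive (p := fun x => (starRingEnd ℂ) (U' x))
    (p' := fun x => (starRingEnd ℂ) (V' x)) (H := fun x => (s x : ℂ)⁻¹ * V x)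
    (a := -Real.pi) (b := Real.pi)
    (fun t _ => (h'.hasDerivAt t).star) hcV hk
    (fun t ht => hs.inv_mul_eq_integral hα h neg_pi_mem_Icc_pi (hIcc ▸ ht))
  -- The boundary terms drop out because an odd periodic function vanishes at `±π`.
  simp only [h'.apply_pi, h'.apply_neg_pi, map_zero, zero_mul, sub_zero] at key
  have i1 : IntervalIntegrable (fun x => (starRingEnd ℂ) (U' x) * ((s x : ℂ)⁻¹ *
      linExpr α ψ U V W x)) volume (-Real.pi) Real.pi :=
    (hL.continuousOn_mul hs.continuous_inv.continuousOn).continuousOn_mul hcU.continuousOn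
  have i2 : IntervalIntegrable (fun x => (α * ((starRingEnd ℂ) (V' x) * ((s x : ℂ)⁻¹ * V x))
        - 2 * ((starRingEnd ℂ) (U' x) * U x))) volume (-Real.pi) Real.pi :=
    ((continuousOn_const.mul (hcV.mul (hs.continuous_inv.continuousOn.mul hVc))).sub
      (continuous_const.mul (hcU.mul h.continuous)).continuousOn).intervalIntegrable
  rw [← sub_eq_zero, ← intervalIntegral.integral_sub i1 i2, ← mul_zero (-(α : ℂ)), ← key,
    ← intervalIntegral.integral_const_mul]
  refine intervalIntegral.integral_congr fun t _ => ?_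
  field_simp
  ring

theorem inner_mulInv_eq_integral (hs : IsGauge α ψ s) {u g : OddL2} {U G : ℝ → ℂ}
    (hu : (u : Lp ℂ 2 muPi) =ᵐ[muPi] U) (hg : (g : Lp ℂ 2 muPi) =ᵐ[muPi] G) :
    inner ℂ u (hs.mulInv g) =
      ∫ x in (-Real.pi)..Real.pi, (starRingEnd ℂ) (U x) * ((s x : ℂ)⁻¹ * G x) := by
  refine inner_OddL2 _ _ hu ?_
  filter_upwards [hs.coeFn_mulInv g, hg] with x h1 h2
  rw [h1, h2]

/-- After integration by parts the form is `∫ (α conj(V') V / s - 2 conj(U') U)`, which is Hermitian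
because `α` and `s` are real. -/
theorem inner_symm_of_mem_linGraph (hs : IsGauge α ψ s) (hα : α ≠ 0) {u g u' g' : OddL2}
    (h : (u, g) ∈ linGraph α ψ) (h' : (u', g') ∈ linGraph α ψ) :
    inner ℂ u' (hs.mulInv g) = (starRingEnd ℂ) (inner ℂ u (hs.mulInv g')) := by
  obtain ⟨U, V, W, hU, hu, hg⟩ := h
  obtain ⟨U', V', W', hU', hu', hg'⟩ := h'
  rw [hs.inner_mulInv_eq_integral hu' hg, hs.inner_mulInv_eq_integral hu hg',
    hs.integral_conj_mul_linExpr hα hU hU', hs.integral_conj_mul_linExpr hα hU' hU,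
    intervalIntegral.integral_of_le (by linarith [Real.pi_pos]),
    intervalIntegral.integral_of_le (by linarith [Real.pi_pos]), ← integral_conj]
  refine integral_congr_ae (Filter.Eventually.of_forall fun x => ?_)
  simp only [map_sub, map_mul, map_inv₀, Complex.conj_ofReal, Complex.conj_conj, map_ofNat]
  ring

theorem im_eq_zero_of_eigenvalue (hs : IsGauge α ψ s) (hα : α ≠ 0) {z : ℂ} {u : OddL2} (hu : u ≠ 0)
    (h : (u, z • u) ∈ linGraph α ψ) : z.im = 0 := by
  have h1 := hs.inner_symm_of_mem_linGraph hα h h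
  have e : inner ℂ u (z • hs.mulInv u) = z * inner ℂ u (hs.mulInv u) :=
    inner_smul_right (𝕜 := ℂ) (E := OddL2) u (hs.mulInv u) z
  rw [map_smul, e, hs.inner_mulInv, map_mul,
    inner_conj_symm (𝕜 := ℂ) (E := OddL2)] at h1
  have h2 := mul_right_cancel₀ ((inner_self_ne_zero (𝕜 := ℂ) (E := OddL2)).2 (hs.mulSqrtInv_ne_zero hu)) h1
  exact Complex.conj_eq_iff_im.1 h2.symm

end IsGauge

/-! ### Sturm comparison -/

theorem deriv_nonneg_of_pos_right {y : ℝ → ℝ} {y' a b : ℝ} (hy : HasDerivAt y y' a) (ha : y a = 0)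
    (hab : a < b) (hpos : ∀ x ∈ Ioo a b, 0 < y x) : 0 ≤ y' := by
  have h := (hasDerivWithinAt_iff_tendsto_slope' (s := Ioi a) (by simp)).1 hy.hasDerivWithinAt
  refine ge_of_tendsto h ?_
  filter_upwards [Ioo_mem_nhdsGT hab] with x hx
  rw [slope_def_field, ha, sub_zero]
  exact div_nonneg (hpos x hx).le (by linarith [hx.1])

theorem deriv_nonpos_of_pos_left {y : ℝ → ℝ} {y' a b : ℝ} (hy : HasDerivAt y y' b) (hb : y b = 0)
    (hab : a < b) (hpos : ∀ x ∈ Ioo a b, 0 < y x) : y' ≤ 0 := by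
  have h := (hasDerivWithinAt_iff_tendsto_slope' (s := Iio b) (by simp)).1 hy.hasDerivWithinAt
  refine le_of_tendsto h ?_
  filter_upwards [Ioo_mem_nhdsLT hab] with x hx
  rw [slope_def_field, hb, sub_zero]
  exact div_nonpos_of_nonneg_of_nonpos (hpos x hx).le (by linarith [hx.2])

/-- A continuous function which vanishes at the ends of an interval and is positive at an inner
point is positive between two consecutive zeros. -/
theorem exists_consecutive_zeros {y : ℝ → ℝ} (hy : Continuous y) {p q x₀ : ℝ} (hp : y p = 0)
    (hq : y q = 0) (hx₀ : x₀ ∈ Ioo p q) (hpos : 0 < y x₀) :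
    ∃ a b, p ≤ a ∧ b ≤ q ∧ a < b ∧ y a = 0 ∧ y b = 0 ∧ ∀ x ∈ Ioo a b, 0 < y x := by
  have hclosed : IsClosed {x | y x = 0} := isClosed_eq hy continuous_const
  obtain ⟨a, ⟨ha, ha0⟩, hamax⟩ := (isCompact_Icc.inter_right hclosed :
    IsCompact (Icc p x₀ ∩ {x | y x = 0})).exists_isGreatest ⟨p, ⟨le_rfl, hx₀.1.le⟩, hp⟩
  obtain ⟨b, ⟨hb, hb0⟩, hbmin⟩ := (isCompact_Icc.inter_right hclosed :
    IsCompact (Icc x₀ q ∩ {x | y x = 0})).exists_isLeast ⟨q, ⟨hx₀.2.le, le_rfl⟩, hq⟩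
  have ha0 : y a = 0 := ha0
  have hb0 : y b = 0 := hb0
  have hax : a < x₀ := lt_of_le_of_ne ha.2 fun h => hpos.ne' (h ▸ ha0)
  have hxb : x₀ < b := lt_of_le_of_ne hb.1 fun h => hpos.ne' (h ▸ hb0)
  refine ⟨a, b, ha.1, hb.2, hax.trans hxb, ha0, hb0, fun x hx => ?_⟩
  by_contra hneg
  push Not at hneg
  rcases le_total x x₀ with hxx | hxx
  · obtain ⟨t, ht, ht0⟩ := intermediate_value_Icc hxx hy.continuousOn ⟨hneg, hpos.le⟩
    have := hamax ⟨⟨by linarith [ha.1, hx.1, ht.1], ht.2⟩, ht0⟩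
    linarith [hx.1, ht.1]
  · obtain ⟨t, ht, ht0⟩ := intermediate_value_Icc' hxx hy.continuousOn ⟨hneg, hpos.le⟩
    have := hbmin ⟨⟨ht.1, by linarith [hb.2, hx.2, ht.2]⟩, ht0⟩
    linarith [hx.2, ht.2]

namespace IsGauge

variable {α : ℝ} {ψ s : ℝ → ℝ}

/-- Comparison of a Dirichlet eigenfunction on `(0, π)` with a positive supersolution. -/
theorem le_of_supersolution (hs : IsGauge α ψ s) (hα : 0 < α) {v v₁ v₂ y y₁ : ℝ → ℝ} {c r : ℝ}
    (hv : ∀ x, HasDerivAt v (v₁ x) x) (hv₁ : ∀ x, HasDerivAt v₁ (v₂ x) x)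
    (hpos : ∀ x ∈ Ioo 0 Real.pi, 0 < v x)
    (hsup : ∀ x ∈ Ioo 0 Real.pi, c * v x ≤ -α * v₂ x + 2 * α * ψ x * v₁ x - 2 * s x * v x)
    (hy : ∀ x, HasDerivAt y (y₁ x) x) (hy₁ : ContinuousOn y₁ (Icc 0 Real.pi))
    (hyK : ∀ x ∈ Ioo 0 Real.pi,
      HasDerivAt (fun x => (s x)⁻¹ * y₁ x) (-α⁻¹ * ((s x)⁻¹ * r + 2) * y x) x)
    (hy0 : y 0 = 0) (hyπ : y Real.pi = 0) {x₀ : ℝ} (hx₀ : x₀ ∈ Ioo 0 Real.pi) (hyx₀ : 0 < y x₀) :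
    c ≤ r := by
  by_contra! hr
  have hyc : Continuous y := continuous_iff_continuousAt.2 fun x => (hy x).continuousAt
  have hvc : Continuous v := continuous_iff_continuousAt.2 fun x => (hv x).continuousAt
  have hv₁c : Continuous v₁ := continuous_iff_continuousAt.2 fun x => (hv₁ x).continuousAt
  have hsi : Continuous fun x => (s x)⁻¹ := hs.continuous_s.inv₀ fun x => (hs.pos x).ne'
  have hvnn : ∀ x ∈ Icc 0 Real.pi, 0 ≤ v x := by
    intro x hx
    have hcl : closure (Ioo 0 Real.pi) ⊆ {x | 0 ≤ v x} :=
      closure_minimal (fun t ht => (hpos t ht).le) (isClosed_le continuous_const hvc)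
    rw [closure_Ioo Real.pi_pos.ne] at hcl
    exact hcl hx
  obtain ⟨a, b, ha, hb, hab, ha0, hb0, hyab⟩ := exists_consecutive_zeros hyc hy0 hyπ hx₀ hyx₀
  have hsubc : Icc a b ⊆ Icc 0 Real.pi := Icc_subset_Icc ha hb
  have hsubo : Ioo a b ⊆ Ioo 0 Real.pi := Ioo_subset_Ioo ha hb
  -- The weighted Wronskian has derivative `y / (α s) * (r v - L v)`, which is negative if `r < c`.
  -- At the ends of the nodal interval it equals `-v y' / s`, at most zero at `a` and at least zero
  -- at `b`: a contradiction.
  have hanti : StrictAntiOn (fun x => y x * ((s x)⁻¹ * v₁ x) - v x * ((s x)⁻¹ * y₁ x)) (Icc a b) := by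
    refine strictAntiOn_of_deriv_neg (convex_Icc a b) ?_ fun x hx => ?_
    · exact (hyc.mul (hsi.mul hv₁c)).continuousOn.sub
        (hvc.continuousOn.mul (hsi.continuousOn.mul (hy₁.mono hsubc)))
    · rw [interior_Icc] at hx
      have hsx := hs.pos x
      have d1 := (hs.hasDerivAt x).inv hsx.ne'
      have d := ((hy x).mul (d1.mul (hv₁ x))).sub ((hv x).mul (hyK x (hsubo hx)))
      have d' : deriv (fun x => y x * ((s x)⁻¹ * v₁ x) - v x * ((s x)⁻¹ * y₁ x)) x = _ := d.deriv
      rw [d']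
      have e : y₁ x * ((s x)⁻¹ * v₁ x) + y x * (-(2 * ψ x * s x) / s x ^ 2 * v₁ x + (s x)⁻¹ * v₂ x)
          - (v₁ x * ((s x)⁻¹ * y₁ x) + v x * (-α⁻¹ * ((s x)⁻¹ * r + 2) * y x)) =
          y x / (α * s x) * (r * v x - (-α * v₂ x + 2 * α * ψ x * v₁ x - 2 * s x * v x)) := by
        field_simp
        ring
      refine lt_of_eq_of_lt e (mul_neg_of_pos_of_neg (div_pos (hyab x hx) (mul_pos hα hsx)) ?_)
      have h1 := hsup x (hsubo hx)
      have h2 := mul_lt_mul_of_pos_right hr (hpos x (hsubo hx))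
      linarith
  have hlt := hanti (left_mem_Icc.2 hab.le) (right_mem_Icc.2 hab.le) hab
  simp only [ha0, hb0, zero_mul, zero_sub] at hlt
  have hA := mul_nonneg (hvnn a (hsubc (left_mem_Icc.2 hab.le)))
    (mul_nonneg (inv_nonneg.2 (hs.pos a).le) (deriv_nonneg_of_pos_right (hy a) ha0 hab hyab))
  have hB := mul_nonneg (hvnn b (hsubc (right_mem_Icc.2 hab.le)))
    (mul_nonneg (inv_nonneg.2 (hs.pos b).le)
      (neg_nonneg.2 (deriv_nonpos_of_pos_left (hy b) hb0 hab hyab)))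
  linarith

/-- An eigenfunction is a priori only `H²`, but its equation equates the weak derivative of `U'/s`
with a continuous function almost everywhere, so this derivative exists classically. -/
theorem hasDerivAt_of_eigenvalue (hs : IsGauge α ψ s) (hα : α ≠ 0) {z : ℂ} {u : OddL2}
    {U V W : ℝ → ℂ} (h : IsOddPeriodicH2 U V W) (hu : (u : Lp ℂ 2 muPi) =ᵐ[muPi] U)
    (hg : ((z • u : OddL2) : Lp ℂ 2 muPi) =ᵐ[muPi] linExpr α ψ U V W) {x : ℝ}
    (hx : x ∈ Ioo 0 Real.pi) : HasDerivAt (fun x => (s x : ℂ)⁻¹ * V x)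
      (-(α : ℂ)⁻¹ * ((s x : ℂ)⁻¹ * z + 2) * U x) x := by
  have hae : ∀ᵐ t ∂muPi, -(α : ℂ)⁻¹ * ((s t : ℂ)⁻¹ * linExpr α ψ U V W t + 2 * U t) =
      -(α : ℂ)⁻¹ * ((s t : ℂ)⁻¹ * z + 2) * U t := by
    filter_upwards [hu, hg, Lp.coeFn_smul z (u : Lp ℂ 2 muPi)] with t h1 h2 h3
    rw [← h2]
    have h4 : ((z • u : OddL2) : Lp ℂ 2 muPi) t = z * U t := by
      refine h3.trans ?_
      rw [Pi.smul_apply, h1, smul_eq_mul]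
    rw [h4]
    ring
  have hc : Continuous fun t => -(α : ℂ)⁻¹ * ((s t : ℂ)⁻¹ * z + 2) * U t :=
    (continuous_const.mul ((hs.continuous_inv.mul continuous_const).add continuous_const)).mul
      h.continuous
  have heq : ∀ t ∈ Icc (-Real.pi) Real.pi, (s t : ℂ)⁻¹ * V t = (s 0 : ℂ)⁻¹ * V 0 +
      ∫ t in (0 : ℝ)..t, -(α : ℂ)⁻¹ * ((s t : ℂ)⁻¹ * z + 2) * U t := by
    intro t ht
    rw [hs.inv_mul_eq_integral hα h zero_mem_Icc_pi ht, ← intervalIntegral_muPi zero_mem_Icc_pi ht,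
      ← intervalIntegral_muPi zero_mem_Icc_pi ht]
    congr 1
    exact intervalIntegral.integral_congr_ae (hae.mono fun t ht _ => ht)
  have hd := (intervalIntegral.integral_hasDerivAt_right (hc.intervalIntegrable 0 x)
    (hc.stronglyMeasurableAtFilter _ _) hc.continuousAt).const_add ((s 0 : ℂ)⁻¹ * V 0)
  refine hd.congr_of_eventuallyEq ?_
  filter_upwards [isOpen_Ioo.mem_nhds hx] with t ht
  exact heq t ⟨by linarith [ht.1, Real.pi_pos], ht.2.le⟩

/-- A positive supersolution on `(0, π)` bounds the spectrum from below. -/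
theorem spectrum_of_supersolution (hs : IsGauge α ψ s) (hα : 0 < α) {v v₁ v₂ : ℝ → ℝ} {c : ℝ}
    (hv : ∀ x, HasDerivAt v (v₁ x) x) (hv₁ : ∀ x, HasDerivAt v₁ (v₂ x) x)
    (hpos : ∀ x ∈ Ioo 0 Real.pi, 0 < v x)
    (hsup : ∀ x ∈ Ioo 0 Real.pi, c * v x ≤ -α * v₂ x + 2 * α * ψ x * v₁ x - 2 * s x * v x)
    {z : ℂ} (hz : z ∈ unboundedSpectrum (linOp α ψ)) : z.im = 0 ∧ c ≤ z.re := by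
  obtain ⟨u, hu0, hu⟩ := isUnboundedEigenvalue_linOp_iff.1
    (hs.isUnboundedEigenvalue_of_mem_unboundedSpectrum hα.ne' hz)
  have him := hs.im_eq_zero_of_eigenvalue hα.ne' hu0 hu
  refine ⟨him, ?_⟩
  obtain ⟨U, V, W, hU, huU, hg⟩ := hu
  simp only at huU hg
  have hzr : z = (z.re : ℂ) := Complex.ext rfl him
  have hK : ∀ x ∈ Ioo 0 Real.pi, HasDerivAt (fun x => (s x : ℂ)⁻¹ * V x)
      (-(α : ℂ)⁻¹ * ((s x : ℂ)⁻¹ * z + 2) * U x) x :=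
    fun x hx => hs.hasDerivAt_of_eigenvalue hα.ne' hU huU hg hx
  -- As `z` is real, the real part of any complex multiple of `U` solves the same equation. The
  -- multiplier will be `conj (U x₀)` at a point where `U x₀ ≠ 0`, so that this real part is
  -- positive there.
  have main : ∀ w : ℂ, (∃ x ∈ Ioo 0 Real.pi, 0 < (w * U x).re) → c ≤ z.re := by
    rintro w ⟨x₀, hx₀, hw⟩
    refine hs.le_of_supersolution hα (y := fun x => (w * U x).re) (y₁ := fun x => (w * V x).re)
      hv hv₁ hpos hsup (fun x => ?_) ?_ (fun x hx => ?_) ?_ ?_ hx₀ hw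
    · exact Complex.reCLM.hasFDerivAt.comp_hasDerivAt x ((hU.hasDerivAt x).const_mul w)
    · exact Complex.continuous_re.comp_continuousOn (continuousOn_const.mul
        (hU.continuousOn.mono (Icc_subset_Icc (by linarith [Real.pi_pos]) le_rfl)))
    · have h1 := Complex.reCLM.hasFDerivAt.comp_hasDerivAt x ((hK x hx).const_mul w)
      have e1 : (Complex.reCLM ∘ fun x => w * ((s x : ℂ)⁻¹ * V x)) =
          fun x => (s x)⁻¹ * (w * V x).re := by
        funext t
        rw [comp_apply, Complex.reCLM_apply, ← Complex.re_ofReal_mul]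
        congr 1
        push_cast
        ring
      have e2 : Complex.reCLM (w * (-(α : ℂ)⁻¹ * ((s x : ℂ)⁻¹ * z + 2) * U x)) =
          -α⁻¹ * ((s x)⁻¹ * z.re + 2) * (w * U x).re := by
        rw [Complex.reCLM_apply, ← Complex.re_ofReal_mul]
        congr 1
        nth_rewrite 1 [hzr]
        push_cast
        ring
      rw [e2] at h1
      rw [← e1]
      exact h1
    · simp [hU.apply_zero]
    · simp [hU.apply_pi]
  have hex : ∃ x ∈ Ioo 0 Real.pi, U x ≠ 0 := by
    by_contra! hne
    apply hu0
    refine OddL2_ext (huU.trans ?_)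
    refine Filter.EventuallyEq.trans ?_ (Lp.coeFn_zero ℂ 2 muPi).symm
    filter_upwards [ae_restrict_mem measurableSet_Ioo] with x hx
    rcases lt_trichotomy x 0 with h | h | h
    · have := hU.odd x
      rw [hne (-x) ⟨by linarith, by linarith [hx.1]⟩] at this
      simpa using this.symm
    · rw [h, hU.apply_zero]
      rfl
    · exact hne x ⟨h, hx.2⟩
  obtain ⟨x₀, hx₀, hne⟩ := hex
  refine main ((starRingEnd ℂ) (U x₀)) ⟨x₀, hx₀, ?_⟩
  rw [← Complex.normSq_eq_conj_mul_self, Complex.ofReal_re]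
  exact Complex.normSq_pos.2 hne

end IsGauge

/-! ### Equilibria -/

theorem isGauge_zero (α : ℝ) : IsGauge α (fun _ => 0) (fun _ => 1) where
  eq x := by simp
  pos _ := one_pos
  hasDerivAt x := by simpa using hasDerivAt_const x (1 : ℝ)
  even _ := rfl
  continuous := continuous_const

namespace IsEquilibrium

variable {α : ℝ} {ψ : ℝ → ℝ}

theorem hasDerivAt (h : IsEquilibrium α ψ) (x : ℝ) : HasDerivAt ψ (deriv ψ x) x :=
  (h.contDiff.differentiable (by norm_num) x).hasDerivAt

theorem hasDerivAt_deriv (h : IsEquilibrium α ψ) (hα : α ≠ 0) (x : ℝ) :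
    HasDerivAt (deriv ψ) (2 * ψ x * deriv ψ x - 2 / α * ψ x) x := by
  have h1 : ContDiff ℝ 1 (deriv ψ) :=
    ((contDiff_succ_iff_deriv (n := 1)).1 (by
      rw [one_add_one_eq_two]
      exact h.contDiff)).2.2
  have h2 := (h1.differentiable (by norm_num) x).hasDerivAt
  have h3 := h.equation x
  refine h2.congr_deriv ?_
  field_simp
  linarith

theorem continuous (h : IsEquilibrium α ψ) : Continuous ψ := h.contDiff.continuous

theorem apply_zero (h : IsEquilibrium α ψ) : ψ 0 = 0 := by
  have := h.odd 0
  rw [neg_zero] at this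
  linarith

theorem exists_bound (h : IsEquilibrium α ψ) : ∃ B : ℝ, ∀ x, |ψ x| ≤ B := by
  obtain ⟨B, hB⟩ := isCompact_Icc.exists_bound_of_continuousOn (s := Icc (-Real.pi) Real.pi)
    h.continuous.continuousOn
  refine ⟨B, Function.Periodic.forall_of_Icc (fun x => ?_) hB⟩
  rw [h.periodic x]

/-- The linear equation `s' = 2 ψ s` makes `s exp(-2 ∫ ψ)` constant. Rolle's theorem over a period
provides a point where `s = 1`, so the constant is positive. -/
theorem isGauge (h : IsEquilibrium α ψ) (hα : α ≠ 0) :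
    IsGauge α ψ fun x => 1 - α * deriv ψ x := by
  have hπ := Real.pi_pos
  have hd : ∀ x, HasDerivAt (fun x => 1 - α * deriv ψ x) (2 * ψ x * (1 - α * deriv ψ x)) x := by
    intro x
    refine (((h.hasDerivAt_deriv hα x).const_mul α).const_sub 1).congr_deriv ?_
    field_simp
    ring
  refine ⟨fun _ => rfl, fun x => ?_, hd, fun x => ?_, h.continuous⟩
  · obtain ⟨c, -, hc⟩ := exists_deriv_eq_zero (f := ψ) (a := -Real.pi) (b := Real.pi) (by linarith)
      h.continuous.continuousOn (by
        rw [← h.periodic (-Real.pi)]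
        congr 1
        ring)
    have hΨ : ∀ x, HasDerivAt (fun x => ∫ t in (0 : ℝ)..x, ψ t) (ψ x) x := fun x =>
      intervalIntegral.integral_hasDerivAt_right (h.continuous.intervalIntegrable _ _)
        (h.continuous.stronglyMeasurableAtFilter _ _) h.continuous.continuousAt
    have hconst := is_const_of_deriv_eq_zero
      (f := fun x => (1 - α * deriv ψ x) * Real.exp (-2 * ∫ t in (0 : ℝ)..x, ψ t))
      (fun x => ((hd x).mul (((hΨ x).const_mul (-2)).exp)).differentiableAt) (fun x => by
        have d := (hd x).mul (((hΨ x).const_mul (-2)).exp)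
        have d' : deriv (fun x => (1 - α * deriv ψ x) *
          Real.exp (-2 * ∫ t in (0 : ℝ)..x, ψ t)) x = _ := d.deriv
        rw [d']
        ring) x c
    simp only [hc, mul_zero, sub_zero, one_mul] at hconst
    refine pos_of_mul_pos_left (b := Real.exp (-2 * ∫ t in (0 : ℝ)..x, ψ t)) ?_ (Real.exp_pos _).le
    rw [hconst]
    exact Real.exp_pos _
  · have h1 : (fun x => ψ (-x)) = fun x => -ψ x := funext h.odd
    have h2 := deriv_comp_neg ψ x
    rw [h1, deriv.fun_neg] at h2
    rw [← neg_injective h2]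

end IsEquilibrium

/-! ### Uniqueness, symmetry about zeros, and the supersolution -/

/-- Uniqueness for the equilibrium equation. -/
theorem equilibrium_unique {α B x₀ : ℝ} {f f₁ g g₁ : ℝ → ℝ} (hf : ∀ x, HasDerivAt f (f₁ x) x)
    (hf₁ : ∀ x, HasDerivAt f₁ (2 * f x * f₁ x - 2 / α * f x) x) (hfB : ∀ x, |f x| ≤ B)
    (hg : ∀ x, HasDerivAt g (g₁ x) x)
    (hg₁ : ∀ x, HasDerivAt g₁ (2 * g x * g₁ x - 2 / α * g x) x) (hgB : ∀ x, |g x| ≤ B)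
    (h0 : f x₀ = g x₀) (h1 : f₁ x₀ = g₁ x₀) (x : ℝ) : f x = g x := by
  set d : ℝ → ℝ := fun x => f x - g x with hd
  -- In the variables `f` and `f' - f²` the nonlinearity disappears from the second equation, `(f' -
  -- f²)' = -(2/α) f`. The energy estimate then needs a bound on the solutions only, not on their
  -- derivatives.
  set e : ℝ → ℝ := fun x => (f₁ x - f x ^ 2) - (g₁ x - g x ^ 2) with he
  set E : ℝ → ℝ := fun x => d x ^ 2 + e x ^ 2 with hE
  set C : ℝ := 4 * B + 1 + |2 / α| with hC
  set E' : ℝ → ℝ := fun x => 2 * d x * ((f x + g x) * d x + e x) + 2 * e x * (-(2 / α) * d x) with hE'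
  have hdd : ∀ x, HasDerivAt d ((f x + g x) * d x + e x) x := fun x =>
    ((hf x).sub (hg x)).congr_deriv (by simp only [d, e]; ring)
  have hed : ∀ x, HasDerivAt e (-(2 / α) * d x) x := fun x =>
    (((hf₁ x).sub ((hf x).pow 2)).sub ((hg₁ x).sub ((hg x).pow 2))).congr_deriv
      (by simp only [d]; ring)
  have hEd : ∀ x, HasDerivAt E (E' x) x := fun x =>
    (((hdd x).pow 2).add ((hed x).pow 2)).congr_deriv (by simp only [E']; ring)
  have hbound : ∀ x, |E' x| ≤ C * E x := by
    intro x
    have hfx := abs_le.1 (hfB x)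
    have hgx := abs_le.1 (hgB x)
    have h3 : |(f x + g x) * (2 * d x ^ 2)| ≤ 2 * B * (2 * d x ^ 2) := by
      rw [abs_mul, abs_of_nonneg (by positivity : (0 : ℝ) ≤ 2 * d x ^ 2)]
      exact mul_le_mul_of_nonneg_right (abs_le.2 ⟨by linarith, by linarith⟩) (by positivity)
    have h4 : |2 * d x * e x| ≤ d x ^ 2 + e x ^ 2 :=
      abs_le.2 ⟨by nlinarith [sq_nonneg (d x + e x)], by nlinarith [sq_nonneg (d x - e x)]⟩
    have h5 : |-(2 / α) * (2 * d x * e x)| ≤ |2 / α| * (d x ^ 2 + e x ^ 2) := by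
      rw [abs_mul, abs_neg]
      exact mul_le_mul_of_nonneg_left h4 (abs_nonneg _)
    have hB : 0 ≤ B := (abs_nonneg _).trans (hfB x)
    have e1 : E' x = (f x + g x) * (2 * d x ^ 2) + 2 * d x * e x + -(2 / α) * (2 * d x * e x) := by
      simp only [E']
      ring
    rw [e1]
    refine (abs_add_three _ _ _).trans ?_
    simp only [C, E]
    nlinarith [sq_nonneg (e x), mul_nonneg hB (sq_nonneg (e x))]
  have hE0 : E x₀ = 0 := by simp [E, d, e, h0, h1]
  have hEnn : ∀ x, 0 ≤ E x := fun x => by positivity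
  have hexp : ∀ (k x : ℝ), HasDerivAt (fun x => E x * Real.exp (k * x))
      ((E' x + k * E x) * Real.exp (k * x)) x := fun k x =>
    ((hEd x).mul (((hasDerivAt_id x).const_mul k).exp)).congr_deriv (by simp only [id]; ring)
  -- Grönwall's argument from `|E'| ≤ C E` and `E x₀ = 0`, to the right and to the left of `x₀`.
  have hEx : E x ≤ 0 := by
    rcases le_total x₀ x with hx | hx
    · have hanti : Antitone fun x => E x * Real.exp (-C * x) :=
        antitone_of_deriv_nonpos (fun x => (hexp _ x).differentiableAt) fun x => by
          rw [(hexp _ x).deriv]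
          refine mul_nonpos_of_nonpos_of_nonneg ?_ (Real.exp_pos _).le
          linarith [(abs_le.1 (hbound x)).2]
      have := hanti hx
      simp only [hE0, zero_mul] at this
      exact nonpos_of_mul_nonpos_left this (Real.exp_pos _)
    · have hmono : Monotone fun x => E x * Real.exp (C * x) :=
        monotone_of_deriv_nonneg (fun x => (hexp _ x).differentiableAt) fun x => by
          rw [(hexp _ x).deriv]
          refine mul_nonneg ?_ (Real.exp_pos _).le
          linarith [(abs_le.1 (hbound x)).1]
      have := hmono hx
      simp only [hE0, zero_mul] at this
      exact nonpos_of_mul_nonpos_left this (Real.exp_pos _)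
  have hdx : d x ^ 2 ≤ 0 := by
    have : E x = d x ^ 2 + e x ^ 2 := rfl
    linarith [sq_nonneg (e x)]
  have := pow_eq_zero_iff (two_ne_zero) |>.1 (le_antisymm hdx (sq_nonneg _))
  exact sub_eq_zero.1 this

namespace IsEquilibrium

variable {α : ℝ} {ψ : ℝ → ℝ}

theorem eq_zero_of_apply_eq_zero (h : IsEquilibrium α ψ) (hα : α ≠ 0) {x₀ : ℝ} (h0 : ψ x₀ = 0)
    (h1 : deriv ψ x₀ = 0) (x : ℝ) : ψ x = 0 := by
  obtain ⟨B, hB⟩ := h.exists_bound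
  exact equilibrium_unique (α := α) (B := B) (x₀ := x₀) (g := fun _ => 0) (g₁ := fun _ => 0)
    h.hasDerivAt (h.hasDerivAt_deriv hα) hB (fun x => hasDerivAt_const x 0)
    (fun x => by simpa using hasDerivAt_const x (0 : ℝ))
    (fun x => by simpa using (abs_nonneg _).trans (hB 0)) h0 h1 x

/-- An equilibrium is symmetric about each of its zeros. -/
theorem periodic_of_apply_eq_zero (h : IsEquilibrium α ψ) (hα : α ≠ 0) {x₀ : ℝ} (h0 : ψ x₀ = 0) :
    Periodic ψ (2 * x₀) := by
  obtain ⟨B, hB⟩ := h.exists_bound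
  have hsub : ∀ x : ℝ, HasDerivAt (fun x => 2 * x₀ - x) (-1) x := fun x => by
    simpa using (hasDerivAt_id x).const_sub (2 * x₀)
  -- The point reflection of `ψ` about `x₀` solves the same equation with the same data at `x₀`.
  -- Composed with oddness about `0`, it is a translation by `2 x₀`.
  have key := equilibrium_unique (α := α) (B := B) (x₀ := x₀) (g := fun x => -ψ (2 * x₀ - x))
    (g₁ := fun x => deriv ψ (2 * x₀ - x)) h.hasDerivAt (h.hasDerivAt_deriv hα) hB
    (fun x => ((h.hasDerivAt (2 * x₀ - x)).comp x (hsub x)).neg.congr_deriv (by ring))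
    (fun x => ((h.hasDerivAt_deriv hα (2 * x₀ - x)).comp x (hsub x)).congr_deriv (by ring))
    (fun x => by rw [abs_neg]; exact hB _)
    (by rw [show 2 * x₀ - x₀ = x₀ by ring, h0, neg_zero])
    (by rw [show 2 * x₀ - x₀ = x₀ by ring])
  intro x
  rw [key (x + 2 * x₀), show 2 * x₀ - (x + 2 * x₀) = -x by ring, h.odd, neg_neg]

theorem exists_sign (h : IsEquilibrium α ψ) (hne : ∀ x ∈ Ioo 0 Real.pi, ψ x ≠ 0) :
    ∃ σ : ℝ, ∀ x ∈ Ioo 0 Real.pi, 0 < σ * ψ x := by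
  by_cases hp : ∃ x ∈ Ioo 0 Real.pi, 0 < ψ x
  · obtain ⟨y, hy, hy0⟩ := hp
    refine ⟨1, fun x hx => ?_⟩
    rw [one_mul]
    by_contra! hneg
    obtain ⟨t, ht, ht0⟩ := isPreconnected_Ioo.intermediate_value hx hy h.continuous.continuousOn
      ⟨hneg, hy0.le⟩
    exact hne t ht ht0
  · push Not at hp
    refine ⟨-1, fun x hx => ?_⟩
    have := lt_of_le_of_ne (hp x hx) (hne x hx)
    linarith

/-- The spectrum at an equilibrium without zeros in `(0, π)` is positive: with `s = 1 - α ψ'`, the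
function `ψ (2 + s - ε (1 - s)²)` is a supersolution up to its sign. -/
theorem spectrum_pos (h : IsEquilibrium α ψ) (hα : 0 < α) (hne : ∀ x ∈ Ioo 0 Real.pi, ψ x ≠ 0)
    (hslope : deriv ψ 0 ≠ 0) :
    ∃ c : ℝ, 0 < c ∧ ∀ z ∈ unboundedSpectrum (linOp α ψ), z.im = 0 ∧ c ≤ z.re := by
  have hs := h.isGauge hα.ne'
  set s : ℝ → ℝ := fun x => 1 - α * deriv ψ x with hsdef
  have hψd : ∀ x, HasDerivAt ψ ((1 - s x) / α) x := fun x =>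
    (h.hasDerivAt x).congr_deriv (by simp only [s]; field_simp; ring)
  -- At a zero of `ψ`, `s = 1` would mean `ψ' = 0`, and uniqueness would give `ψ = 0` identically.
  have hnz : ∀ x, ψ x = 0 → s x ≠ 1 := by
    intro x h0 h1
    apply hslope
    have h2 : deriv ψ x = 0 := by
      have : α * deriv ψ x = 0 := by
        simp only [s] at h1
        linarith
      simpa [hα.ne'] using this
    have h3 : ψ = fun _ => 0 := funext (h.eq_zero_of_apply_eq_zero hα.ne' h0 h2)
    rw [h3]
    simp
  obtain ⟨B, hB0, hB⟩ := exists_norm_le_of_continuous hs.continuous_ofReal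
  have hsB : ∀ x ∈ Icc 0 Real.pi, s x ≤ B := by
    intro x hx
    have := hB x ⟨by linarith [hx.1, Real.pi_pos], hx.2⟩
    rw [Complex.norm_real] at this
    exact (le_abs_self _).trans this
  -- Small enough for both `ε (1 - s)² < 2`, so that `g > 0`, and `ε (1 + 5 s) ≤ 1`, so that the
  -- first term of `N` is nonnegative.
  set ε : ℝ := 1 / (6 * (1 + B) ^ 2) with hε
  have hε0 : 0 < ε := by positivity
  have hεB : ε * (1 + B) ^ 2 ≤ 1 / 6 := by
    rw [hε]
    apply le_of_eq
    field_simp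
  set g : ℝ → ℝ := fun x => 2 + s x - ε * (1 - s x) ^ 2 with hg
  -- `L (ψ g) = ψ N`. The first term of `N` vanishes where `s = 1`; there `ψ ≠ 0`, so the second one
  -- is positive. Thus `N > 0` on the closed interval, and the minimum of `N / g` serves as `c`.
  set N : ℝ → ℝ := fun x =>
    2 * ((1 - s x) ^ 2 * (2 - ε * (1 + 5 * s x)) + 4 * α * ε * ψ x ^ 2 * s x ^ 2) with hN
  have hgpos : ∀ x ∈ Icc 0 Real.pi, 0 < g x := by
    intro x hx
    have h1 := hs.pos x
    have h2 := hsB x hx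
    have h3 : (1 - s x) ^ 2 ≤ (1 + B) ^ 2 := by nlinarith
    have h4 : ε * (1 - s x) ^ 2 ≤ ε * (1 + B) ^ 2 := mul_le_mul_of_nonneg_left h3 hε0.le
    simp only [g]
    linarith
  have hNpos : ∀ x ∈ Icc 0 Real.pi, 0 < N x := by
    intro x hx
    have h1 := hs.pos x
    have h2 := hsB x hx
    have h3 : ε * (1 + 5 * s x) ≤ 1 := by
      have h4 : 1 + 5 * s x ≤ 6 * (1 + B) ^ 2 := by nlinarith
      have := mul_le_mul_of_nonneg_left h4 hε0.le
      linarith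
    have h5 : (1 - s x) ^ 2 ≤ (1 - s x) ^ 2 * (2 - ε * (1 + 5 * s x)) :=
      le_mul_of_one_le_right (sq_nonneg _) (by linarith)
    have h6 : 0 < (1 - s x) ^ 2 + 4 * α * ε * ψ x ^ 2 * s x ^ 2 := by
      by_cases h0 : ψ x = 0
      · have : 1 - s x ≠ 0 := sub_ne_zero.2 (hnz x h0).symm
        positivity
      · positivity
    simp only [N]
    linarith
  have hgc : Continuous g :=
    (continuous_const.add hs.continuous_s).sub
      (continuous_const.mul ((continuous_const.sub hs.continuous_s).pow 2))
  have hsc := hs.continuous_s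
  have hψc := h.continuous
  have hNc : Continuous N := by
    simp only [N]
    fun_prop
  obtain ⟨x₁, hx₁, hmin⟩ := (isCompact_Icc (a := (0 : ℝ)) (b := Real.pi)).exists_isMinOn
    ⟨0, le_rfl, Real.pi_pos.le⟩ (hNc.continuousOn.div hgc.continuousOn fun x hx => (hgpos x hx).ne')
  refine ⟨N x₁ / g x₁, div_pos (hNpos x₁ hx₁) (hgpos x₁ hx₁), fun z hz => ?_⟩
  obtain ⟨σ, hσ⟩ := h.exists_sign hne
  have hgd : ∀ x, HasDerivAt g ((1 + 2 * ε * (1 - s x)) * (2 * ψ x * s x)) x := fun x =>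
    (((hs.hasDerivAt x).const_add 2).sub ((((hs.hasDerivAt x).const_sub 1).pow 2).const_mul ε))
      |>.congr_deriv (by simp only [s]; ring)
  refine hs.spectrum_of_supersolution hα (v := fun x => σ * (ψ x * g x))
    (v₁ := fun x => σ * ((1 - s x) / α * g x + ψ x * ((1 + 2 * ε * (1 - s x)) * (2 * ψ x * s x))))
    (v₂ := fun x => σ * (-(2 * ψ x * s x) / α * g x
      + (1 - s x) / α * ((1 + 2 * ε * (1 - s x)) * (2 * ψ x * s x))
      + ((1 - s x) / α * ((1 + 2 * ε * (1 - s x)) * (2 * ψ x * s x))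
      + ψ x * ((-(2 * ε) * (2 * ψ x * s x)) * (2 * ψ x * s x) + (1 + 2 * ε * (1 - s x)) *
        (2 * ((1 - s x) / α) * s x + 2 * ψ x * (2 * ψ x * s x))))))
    (fun x => ?_) (fun x => ?_) (fun x hx => ?_) (fun x hx => ?_) hz
  · exact ((hψd x).mul (hgd x)).const_mul σ
  · have d1 := ((hs.hasDerivAt x).const_sub 1).div_const α
    have d2 := (((hs.hasDerivAt x).const_sub 1).const_mul (2 * ε)).const_add 1
    have d3 := ((hψd x).const_mul 2).mul (hs.hasDerivAt x)
    exact (((d1.mul (hgd x)).add ((hψd x).mul (d2.mul d3))).const_mul σ).congr_deriv (by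
      simp only [Pi.mul_apply]
      ring)
  · rw [← mul_assoc]
    exact mul_pos (hσ x hx) (hgpos x (Ioo_subset_Icc_self hx))
  · have hx' := Ioo_subset_Icc_self hx
    have h1 : N x₁ / g x₁ * g x ≤ N x := (le_div_iff₀ (hgpos x hx')).1 (hmin hx')
    have h2 := mul_le_mul_of_nonneg_left h1 (hσ x hx).le
    refine le_trans (le_of_eq ?_) (h2.trans (le_of_eq ?_))
    · ring
    · simp only [N, g]
      field_simp
      ring

end IsEquilibrium

/-! ### The two cases of positive spectrum -/

theorem spectrum_zero_pos {α : ℝ} (hα : 2 < α) {z : ℂ}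
    (hz : z ∈ unboundedSpectrum (linOp α (fun _ => 0))) : z.im = 0 ∧ α - 2 ≤ z.re := by
  refine (isGauge_zero α).spectrum_of_supersolution (by linarith) (v := Real.sin) (v₁ := Real.cos)
    (v₂ := fun x => -Real.sin x) Real.hasDerivAt_sin Real.hasDerivAt_cos
    (fun x hx => Real.sin_pos_of_mem_Ioo hx) (fun x _ => le_of_eq ?_) hz
  ring

/-- A zero `x₀` in `(0, π)` would be a centre of symmetry and give the period `2 x₀ < 2 π`, against
minimality. -/
theorem spectrum_psi_one_pos {α : ℝ} (hα : 0 < α) {ψ : ℝ → ℝ}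
    (h : IsPsiPlus α 1 ψ ∨ IsPsiMinus α 1 ψ) :
    ∃ c : ℝ, 0 < c ∧ ∀ z ∈ unboundedSpectrum (linOp α ψ), z.im = 0 ∧ c ≤ z.re := by
  obtain ⟨he, hp, hd⟩ : IsEquilibrium α ψ ∧ IsFundamentalPeriod ψ (2 * Real.pi / (1 : ℕ)) ∧
      deriv ψ 0 ≠ 0 := by
    rcases h with h | h
    · exact ⟨h.1, h.2, h.3.ne'⟩
    · exact ⟨h.1, h.2, h.3.ne⟩
  refine he.spectrum_pos hα (fun x hx h0 => ?_) hd
  have := hp.2 ⟨by linarith [hx.1], he.periodic_of_apply_eq_zero hα.ne' h0⟩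
  simp only [Nat.cast_one, div_one] at this
  linarith [hx.2]

/-! ### Negative eigenvalues -/

/-- A compact self-adjoint operator `R` such that `R - R²` is not positive has an eigenvalue outside
`[0, 1]`. -/
theorem exists_eigenvalue_of_inner_neg {H : Type*} [NormedAddCommGroup H] [InnerProductSpace ℂ H]
    [CompleteSpace H] (R : H →L[ℂ] H) (hc : IsCompactOperator R)
    (hsym : ∀ f g : H, inner ℂ (R f) g = inner ℂ f (R g)) {f₀ : H}
    (hneg : (inner ℂ (R f₀) (f₀ - R f₀) : ℂ).re < 0) :
    ∃ μ : ℝ, (μ < 0 ∨ 1 < μ) ∧ ∃ p : H, p ≠ 0 ∧ R p = (μ : ℂ) • p := by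
  set B : H →L[ℂ] H := R - R * R with hB
  have hBapply : ∀ f, B f = R f - R (R f) := fun f => rfl
  have hBsym : ∀ f g : H, inner ℂ (B f) g = inner ℂ f (B g) := by
    intro f g
    rw [hBapply, hBapply, inner_sub_left, inner_sub_right, hsym, hsym, hsym]
  have hBsa : IsSelfAdjoint B := ContinuousLinearMap.isSelfAdjoint_iff_isSymmetric.2 hBsym
  have hBc : IsCompactOperator B := hc.sub (hc.comp_clm R)
  have hnot : ¬ 0 ≤ B := by
    intro h
    have h1 := ((ContinuousLinearMap.nonneg_iff_isPositive B).1 h).re_inner_nonneg_left f₀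
    rw [hBapply, ← map_sub, hsym, ← inner_conj_symm] at h1
    simp only [RCLike.re_to_complex, Complex.conj_re] at h1
    linarith
  -- A self-adjoint operator with nonnegative spectrum is nonnegative by the functional calculus.
  -- The negative spectral value is nonzero, hence an eigenvalue of the compact operator `B`.
  obtain ⟨x, hx, hx0⟩ : ∃ x ∈ spectrum ℝ B, x < 0 := by
    by_contra! hall
    apply hnot
    rw [← cfc_id ℝ B]
    exact cfc_nonneg fun x hx => hall x hx
  have hxC : (x : ℂ) ∈ spectrum ℂ B := (spectrum.algebraMap_mem_iff ℂ).2 hx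
  obtain ⟨f, hf⟩ := ((hBc.hasEigenvalue_iff_mem_spectrum
    (Complex.ofReal_ne_zero.2 hx0.ne)).2 hxC).exists_hasEigenvector
  have hf1 : R f - R (R f) = (x : ℂ) • f := hf.apply_eq_smul
  set r := Real.sqrt (1 - 4 * x) with hr
  have hr2 : r * r = 1 - 4 * x := Real.mul_self_sqrt (by linarith)
  have hr1 : 1 < r := by
    have := Real.sqrt_nonneg (1 - 4 * x)
    nlinarith
  have hprod : (((1 - r) / 2 : ℝ) : ℂ) * (((1 + r) / 2 : ℝ) : ℂ) = x := by
    rw [← Complex.ofReal_mul]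
    congr 1
    linarith
  have hsum : (((1 - r) / 2 : ℝ) : ℂ) + (((1 + r) / 2 : ℝ) : ℂ) = 1 := by
    rw [← Complex.ofReal_add, ← Complex.ofReal_one]
    congr 1
    ring
  set μ₁ : ℂ := (((1 - r) / 2 : ℝ) : ℂ) with hμ₁
  set μ₂ : ℂ := (((1 + r) / 2 : ℝ) : ℂ) with hμ₂
  -- On `f`, `(R - μ₁)(R - μ₂) = R² - R + x` vanishes, where `μ₁ < 0` and `μ₂ > 1` are the roots of
  -- `μ - μ² = x`. So either `f` is an eigenvector for `μ₂`, or `R f - μ₂ f` is one for `μ₁`.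
  by_cases hw : R f - μ₂ • f = 0
  · exact ⟨(1 + r) / 2, Or.inr (by linarith), f, hf.2, sub_eq_zero.1 hw⟩
  · refine ⟨(1 - r) / 2, Or.inl (by linarith), _, hw, ?_⟩
    have e1 : R (R f) = R f - (x : ℂ) • f := by
      rw [← hf1]
      abel
    rw [map_sub, map_smul, e1, ← hprod, ← hμ₁, smul_sub, smul_smul]
    have e2 : μ₁ = 1 - μ₂ := by
      rw [← hsum]
      ring
    rw [e2]
    module

namespace IsGauge

variable {α : ℝ} {ψ s : ℝ → ℝ}

/-- If the weighted quadratic form of the linearized operator takes a negative value, then there is a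
negative eigenvalue. -/
theorem exists_neg_eigenvalue (hs : IsGauge α ψ s) (hα : α ≠ 0) {u g : OddL2}
    (hu : (u, g) ∈ linGraph α ψ) (hneg : (inner ℂ u (hs.mulInv g) : ℂ).re < 0) :
    ∃ l : ℝ, l < 0 ∧ IsUnboundedEigenvalue (linOp α ψ) (l : ℂ) := by
  -- If `-1` is an eigenvalue, nothing is left to prove; otherwise `R = (L + 1)⁻¹` exists and is
  -- compact.
  by_cases hne : IsUnboundedEigenvalue (linOp α ψ) (-1 : ℂ)
  · exact ⟨-1, by norm_num, by push_cast; exact hne⟩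
  obtain ⟨Q, hQ⟩ := hs.isUnit_one_sub_fredholmOp hα hne
  set R : OddL2 →L[ℂ] OddL2 := hs.green.comp (Q⁻¹ : (OddL2 →L[ℂ] OddL2)ˣ).val with hR
  have hRmem : ∀ f : OddL2, (R f, f - R f) ∈ linGraph α ψ := by
    intro f
    set k := (Q⁻¹ : (OddL2 →L[ℂ] OddL2)ˣ).val f with hk
    have h1 : (1 - hs.fredholmOp (-1)) k = f := by
      rw [hk, ← hQ, ← mul_apply_eq_comp, Units.mul_inv, one_apply_eq_self]
    have h2 := hs.green_mem_linGraph hα k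
    rw [sub_apply, one_apply_eq_self, fredholmOp_apply, neg_one_smul] at h1
    have h3 : R f = hs.green k := rfl
    rw [h3]
    convert h2 using 2
    rw [← h1]
    abel
  have hRc : IsCompactOperator R :=
    hs.isCompactOperator_green.comp_clm (Q⁻¹ : (OddL2 →L[ℂ] OddL2)ˣ).val
  -- Conjugation by `√s` turns symmetry in the weighted inner product into symmetry in the standard
  -- one.
  set R' : OddL2 →L[ℂ] OddL2 := hs.mulSqrtInv.comp (R.comp hs.mulSqrt) with hR'
  have hR'apply : ∀ f, R' f = hs.mulSqrtInv (R (hs.mulSqrt f)) := fun f => rfl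
  have hR'c : IsCompactOperator R' := (hRc.comp_clm hs.mulSqrt).clm_comp hs.mulSqrtInv
  have hform : ∀ f f' : OddL2, inner ℂ (R' f) f' = inner ℂ (R (hs.mulSqrt f))
      (hs.mulInv (hs.mulSqrt f')) := by
    intro f f'
    rw [hR'apply, hs.inner_mulSqrtInv, ← hs.mulSqrtInv_mulSqrtInv, hs.mulSqrtInv_mulSqrt]
  have hR'sym : ∀ f f' : OddL2, inner ℂ (R' f) f' = inner ℂ f (R' f') := by
    intro f f'
    rw [← inner_conj_symm (𝕜 := ℂ) (E := OddL2) f, hform, hform]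
    set a := R (hs.mulSqrt f)
    set b := R (hs.mulSqrt f')
    have h1 := hs.inner_symm_of_mem_linGraph hα (hRmem (hs.mulSqrt f')) (hRmem (hs.mulSqrt f))
    have h2 : inner ℂ a (hs.mulInv b) = (starRingEnd ℂ) (inner ℂ b (hs.mulInv a)) := by
      rw [hs.inner_mulInv, hs.inner_mulInv, inner_conj_symm (𝕜 := ℂ) (E := OddL2)]
    rw [map_sub, map_sub, inner_sub_right (𝕜 := ℂ) (E := OddL2),
      inner_sub_right (𝕜 := ℂ) (E := OddL2), map_sub, h2] at h1
    exact sub_left_injective h1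
  have hRu : R (g + u) = u := by
    have h1 := hs.green_of_mem_linGraph hα hu
    have h2 : g + u = Q.val (g + (2 : ℂ) • hs.mulS u) := by
      rw [hQ, sub_apply, one_apply_eq_self, fredholmOp_apply, h1, neg_one_smul]
      abel
    have h3 : (Q⁻¹ : (OddL2 →L[ℂ] OddL2)ˣ).val (Q.val (g + (2 : ℂ) • hs.mulS u)) =
        g + (2 : ℂ) • hs.mulS u := by
      rw [← mul_apply_eq_comp, Units.inv_mul, one_apply_eq_self]
    rw [hR, ContinuousLinearMap.comp_apply, h2, h3, h1]
  -- For `f₀ = (L + 1) u / √s` one has `R' f₀ = u / √s` and `f₀ - R' f₀ = L u / √s`, so the required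
  -- inner product is the weighted form at `u`.
  obtain ⟨μ, hμ, p, hp0, hp⟩ := exists_eigenvalue_of_inner_neg R' hR'c hR'sym
    (f₀ := hs.mulSqrtInv (g + u)) (by
      have e1 : R' (hs.mulSqrtInv (g + u)) = hs.mulSqrtInv u := by
        rw [hR'apply, hs.mulSqrt_mulSqrtInv, hRu]
      rw [e1, ← map_sub, add_sub_cancel_right, ← hs.inner_mulInv]
      exact hneg)
  have hμ0 : (μ : ℂ) ≠ 0 := Complex.ofReal_ne_zero.2 (by rcases hμ with h | h <;> linarith)
  have hq0 : hs.mulSqrt p ≠ 0 := by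
    intro h
    apply hp0
    rw [← hs.mulSqrtInv_mulSqrt p, h, map_zero]
  have hq : R (hs.mulSqrt p) = (μ : ℂ) • hs.mulSqrt p := by
    rw [← hs.mulSqrt_mulSqrtInv (R (hs.mulSqrt p)), ← hR'apply, hp, map_smul]
  -- An eigenvalue `μ` of `(L + 1)⁻¹` corresponds to `μ⁻¹ - 1` for `L`, which is negative exactly
  -- for `μ` outside `[0, 1]`.
  refine ⟨μ⁻¹ - 1, ?_, isUnboundedEigenvalue_linOp_iff.2 ⟨hs.mulSqrt p, hq0, ?_⟩⟩
  · rcases hμ with h | h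
    · linarith [inv_neg''.2 h]
    · linarith [inv_lt_one_of_one_lt₀ h]
  · have h1 := (linGraph α ψ).smul_mem ((μ : ℂ)⁻¹) (hRmem (hs.mulSqrt p))
    rw [hq, Prod.smul_mk, smul_sub, inv_smul_smul₀ hμ0] at h1
    convert h1 using 2
    push_cast
    rw [sub_smul, one_smul]

end IsGauge

theorem isUnboundedEigenvalue_zero (α : ℝ) :
    IsUnboundedEigenvalue (linOp α (fun _ => 0)) ((α - 2 : ℝ) : ℂ) := by
  have hsin : Continuous fun x : ℝ => Complex.sin x :=
    Complex.continuous_sin.comp Complex.continuous_ofReal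
  have hm := memLp_of_continuous hsin 2
  have hodd : hm.toLp _ ∈ OddL2 := by
    change ∀ᵐ x ∂muPi, hm.toLp _ (-x) = -hm.toLp _ x
    filter_upwards [hm.coeFn_toLp, measurePreserving_neg_muPi.quasiMeasurePreserving.ae hm.coeFn_toLp]
      with x h1 h2
    rw [h1, h2]
    simp
  have hH2 : IsOddPeriodicH2 (fun x : ℝ => Complex.sin x) (fun x => Complex.cos x)
      (fun x => -Complex.sin x) := by
    refine ⟨fun x => by simp, fun x => ?_, fun x => (Complex.hasDerivAt_sin x).comp_ofReal,
      (memLp_of_continuous hsin 2).neg, fun x _ => ?_⟩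
    · push_cast
      exact Complex.sin_add_two_pi x
    · rw [intervalIntegral.integral_eq_sub_of_hasDerivAt
        (fun t _ => (Complex.hasDerivAt_cos t).comp_ofReal) (hsin.neg.intervalIntegrable _ _)]
      ring
  refine isUnboundedEigenvalue_linOp_iff.2 ⟨⟨hm.toLp _, hodd⟩, fun h0 => ?_, _, _, _, hH2,
    hm.coeFn_toLp, ?_⟩
  · have h1 : hm.toLp _ = 0 := congrArg Subtype.val h0
    have h2 : (fun x : ℝ => Complex.sin x) =ᵐ[muPi] 0 :=
      hm.coeFn_toLp.symm.trans ((Lp.ext_iff.1 h1).trans (Lp.coeFn_zero ℂ 2 muPi))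
    have h3 := Measure.eqOn_open_of_ae_eq h2 isOpen_Ioo hsin.continuousOn continuousOn_const
      (show Real.pi / 2 ∈ Ioo (-Real.pi) Real.pi from
        ⟨by linarith [Real.pi_pos], by linarith [Real.pi_pos]⟩)
    simp at h3
  · have h1 := Lp.coeFn_smul (((α - 2 : ℝ) : ℂ)) (hm.toLp _)
    filter_upwards [h1, hm.coeFn_toLp] with x h1 h2
    refine h1.trans ?_
    rw [Pi.smul_apply, h2]
    simp [linExpr]
    ring

/-! ### A test function supported in one period -/

/-- The integral over `[0, x]` of a function which is a derivative on `(0, P]` and vanishes beyond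
`P`. -/
theorem integral_truncated {h k K : ℝ → ℂ} {P x : ℝ} (hP : 0 ≤ P) (hx : 0 ≤ x)
    (hK : ∀ t, HasDerivAt K (k t) t) (hk : Continuous k) (h1 : ∀ t ∈ Ioc 0 P, h t = k t)
    (h2 : ∀ t, P < t → h t = 0) : ∫ t in (0 : ℝ)..x, h t = K (min x P) - K 0 := by
  have hle : ∀ y, 0 ≤ y → y ≤ P → IntervalIntegrable h volume 0 y ∧
      ∫ t in (0 : ℝ)..y, h t = K y - K 0 := by
    intro y hy0 hyP
    have e : EqOn k h (uIoc 0 y) := fun t ht => by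
      rw [uIoc_of_le hy0] at ht
      exact (h1 t ⟨ht.1, ht.2.trans hyP⟩).symm
    refine ⟨(hk.intervalIntegrable 0 y).congr e, ?_⟩
    rw [← intervalIntegral.integral_eq_sub_of_hasDerivAt (fun t _ => hK t)
      (hk.intervalIntegrable 0 y)]
    exact intervalIntegral.integral_congr_ae (Filter.Eventually.of_forall fun t ht => (e ht).symm)
  rcases le_total x P with hxP | hPx
  · rw [min_eq_left hxP]
    exact (hle x hx hxP).2
  · rw [min_eq_right hPx]
    have e : EqOn (fun _ => (0 : ℂ)) h (uIoc P x) := fun t ht => by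
      rw [uIoc_of_le hPx] at ht
      exact (h2 t ht.1).symm
    have hi : IntervalIntegrable h volume P x :=
      (continuous_const.intervalIntegrable (μ := volume) P x).congr e
    have h0 : ∫ t in P..x, h t = 0 := by
      rw [← intervalIntegral.integral_zero (μ := volume) (a := P) (b := x) (E := ℂ)]
      exact intervalIntegral.integral_congr_ae (Filter.Eventually.of_forall fun t ht => (e ht).symm)
    rw [← intervalIntegral.integral_add_adjacent_intervals (hle P hP le_rfl).1 hi, h0, add_zero]
    exact (hle P hP le_rfl).2

theorem integral_eq_two_mul_of_even {f : ℝ → ℂ} {a : ℝ} (ha : 0 ≤ a)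
    (hf : ∀ x ∈ Icc 0 a, f (-x) = f x) (hi : IntervalIntegrable f volume (-a) a) :
    ∫ x in (-a)..a, f x = 2 * ∫ x in (0 : ℝ)..a, f x := by
  have hsub : ∀ {b c : ℝ}, b ∈ Icc (-a) a → c ∈ Icc (-a) a → uIcc b c ⊆ uIcc (-a) a := by
    intro b c hb hc
    rw [uIcc_of_le (by linarith : -a ≤ a)]
    exact uIcc_subset_Icc hb hc
  have i1 := hi.mono_set (hsub (b := -a) (c := 0) ⟨le_rfl, by linarith⟩ ⟨by linarith, ha⟩)
  have i2 := hi.mono_set (hsub (b := 0) (c := a) ⟨by linarith, ha⟩ ⟨by linarith, le_rfl⟩)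
  have h1 := intervalIntegral.integral_comp_neg (a := 0) (b := a) f
  rw [neg_zero] at h1
  rw [← intervalIntegral.integral_add_adjacent_intervals i1 i2, ← h1, two_mul]
  congr 1
  exact intervalIntegral.integral_congr fun t ht => hf t (by rwa [uIcc_of_le ha] at ht)

/-- The odd function equal to `1` on `(0, P]` and vanishing beyond `P`. -/
def oddStep (P : ℝ) (x : ℝ) : ℂ :=
  (Ioc 0 P).indicator (fun _ => 1) x - (Ioc 0 P).indicator (fun _ => 1) (-x)

theorem oddStep_neg (P x : ℝ) : oddStep P (-x) = -oddStep P x := by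
  simp [oddStep]

theorem oddStep_of_mem {P x : ℝ} (hx : x ∈ Ioc 0 P) : oddStep P x = 1 := by
  rw [oddStep, indicator_of_mem hx, indicator_of_notMem (fun h => by linarith [h.1, hx.1]), sub_zero]

theorem oddStep_of_lt {P x : ℝ} (hP : 0 ≤ P) (hx : P < x) : oddStep P x = 0 := by
  rw [oddStep, indicator_of_notMem (fun h => by linarith [h.2]),
    indicator_of_notMem (fun h => by linarith [h.1]), sub_zero]

theorem oddStep_zero (P : ℝ) : oddStep P 0 = 0 := by
  simp [oddStep]

theorem memLp_oddStep (P : ℝ) : MemLp (oddStep P) 2 muPi := by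
  have h : MemLp ((Ioc 0 P).indicator fun _ => (1 : ℂ)) 2 muPi :=
    memLp_indicator_const 2 measurableSet_Ioc 1 (Or.inr (measure_ne_top _ _))
  exact h.sub (h.comp_measurePreserving measurePreserving_neg_muPi)

/-- The class of `oddStep` in `OddL2`. -/
def oddStepL2 (P : ℝ) : OddL2 :=
  ⟨(memLp_oddStep P).toLp _, by
    change ∀ᵐ x ∂muPi, (memLp_oddStep P).toLp _ (-x) = -(memLp_oddStep P).toLp _ x
    have h := (memLp_oddStep P).coeFn_toLp
    filter_upwards [h, measurePreserving_neg_muPi.quasiMeasurePreserving.ae h] with x h1 h2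
    rw [h1, h2, oddStep_neg]⟩

theorem coeFn_oddStepL2 (P : ℝ) : (oddStepL2 P : Lp ℂ 2 muPi) =ᵐ[muPi] oddStep P :=
  (memLp_oddStep P).coeFn_toLp

namespace IsEquilibrium

variable {α : ℝ} {ψ : ℝ → ℝ}

/-- If a period `P ≤ π` fits into `[0, π]`, the odd function equal to `s - s 0` on `[0, P]` and
vanishing on `[P, π]` makes the weighted quadratic form negative. -/
theorem exists_neg_eigenvalue (h : IsEquilibrium α ψ) (hα : α ≠ 0) {P : ℝ} (hP : 0 < P)
    (hPπ : P ≤ Real.pi) (hper : Periodic ψ P) (hslope : deriv ψ 0 ≠ 0) :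
    ∃ l : ℝ, l < 0 ∧ IsUnboundedEigenvalue (linOp α ψ) (l : ℂ) := by
  have hπ := Real.pi_pos
  have hs := h.isGauge hα
  set s : ℝ → ℝ := fun x => 1 - α * deriv ψ x with hsdef
  set q₀ : ℝ := α * deriv ψ 0 with hq₀
  have hs0 : s 0 = 1 - q₀ := rfl
  have hq₀ne : q₀ ≠ 0 := mul_ne_zero hα hslope
  have hψd : ∀ x, HasDerivAt ψ ((1 - s x) / α) x := fun x =>
    (h.hasDerivAt x).congr_deriv (by simp only [s]; field_simp; ring)
  have hψP : ψ P = 0 := by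
    have := hper 0
    rwa [zero_add, h.apply_zero] at this
  have hsP : s P = s 0 := by
    have h1 : deriv ψ (0 + P) = deriv ψ 0 := by
      rw [← deriv_comp_add_const]
      congr 1
      exact funext hper
    simp only [s]
    rw [← h1, zero_add]
  set w : ℝ → ℝ := fun x => 2 * ((1 - s x) / α) * s x + 2 * ψ x * (2 * ψ x * s x) with hw
  have hsc := hs.continuous_s
  have hψc := h.continuous
  have hwc : Continuous w := by
    simp only [w]
    fun_prop
  have hwd : ∀ x, HasDerivAt (fun x => ((2 * ψ x * s x : ℝ) : ℂ)) (w x : ℂ) x := fun x =>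
    (((hψd x).const_mul 2).mul (hs.hasDerivAt x)).ofReal_comp
  have hwe : ∀ x, w (-x) = w x := by
    intro x
    simp only [w]
    rw [hs.even, h.odd]
    ring
  have hwcC : Continuous fun x => (w x : ℂ) := Complex.continuous_ofReal.comp hwc
  -- The derivative `s' = 2 ψ s` frozen beyond `P`, where it is zero since `ψ P = 0`. It is
  -- continuous, and `s P = s 0` makes its mean vanish.
  set v : ℝ → ℂ := fun x => ((2 * ψ (min |x| P) * s (min |x| P) : ℝ) : ℂ) with hv
  have hvc : Continuous v := by
    simp only [v]
    fun_prop
  have hve : ∀ x, v (-x) = v x := fun x => by simp only [v, abs_neg]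
  have hv1 : ∀ t ∈ Ioc 0 P, v t = ((2 * ψ t * s t : ℝ) : ℂ) := fun t ht => by
    simp only [v]
    rw [abs_of_pos ht.1, min_eq_left ht.2]
  have hv2 : ∀ t, P < t → v t = 0 := fun t ht => by
    simp only [v]
    rw [abs_of_pos (hP.trans ht), min_eq_right ht.le, hψP]
    simp
  have hv0 : v 0 = 0 := by
    simp only [v]
    rw [abs_zero, min_eq_left hP.le, h.apply_zero]
    simp
  have hvint : ∀ x, 0 ≤ x → ∫ t in (0 : ℝ)..x, v t = s (min x P) - s 0 := fun x hx =>
    integral_truncated hP.le hx (fun t => (hs.hasDerivAt t).ofReal_comp)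
      (Complex.continuous_ofReal.comp (by fun_prop)) hv1 hv2
  have hmean : ∫ t in (-Real.pi)..Real.pi, v t = 0 := by
    rw [integral_eq_two_mul_of_even hπ.le (fun x _ => hve x) (hvc.intervalIntegrable _ _),
      hvint _ hπ.le, min_eq_right hPπ, hsP, sub_self, mul_zero]
  set W : ℝ → ℂ := fun x => oddStep P x * w x with hW
  have hWneg : ∀ x, W (-x) = -W x := fun x => by
    simp only [W]
    rw [oddStep_neg, hwe, neg_mul]
  have hWm : MemLp W 2 muPi := by
    have h1 := coeFn_mulLp (fun x => (w x : ℂ)) hwcC (oddStepL2 P)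
    refine (Lp.memLp (mulLp (fun x => (w x : ℂ)) hwcC (oddStepL2 P))).ae_eq ?_
    filter_upwards [h1, coeFn_oddStepL2 P] with x h1 h2
    rw [h1, h2, mul_comm]
  have hvW0 : ∀ x, 0 ≤ x → v x = ∫ t in (0 : ℝ)..x, W t := by
    intro x hx
    rw [integral_truncated hP.le hx hwd hwcC
      (fun t ht => by simp only [W]; rw [oddStep_of_mem ht, one_mul])
      (fun t ht => by simp only [W]; rw [oddStep_of_lt hP.le ht, zero_mul]), h.apply_zero]
    simp only [v]
    rw [abs_of_nonneg hx]
    simp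
  have hvW : ∀ x ∈ Icc (-Real.pi) Real.pi, v x = v 0 + ∫ t in (0 : ℝ)..x, W t := by
    intro x _
    rw [hv0, zero_add]
    rcases le_total 0 x with hx | hx
    · exact hvW0 x hx
    · have h1 := intervalIntegral.integral_comp_neg (a := 0) (b := -x) W
      simp only [hWneg, neg_zero, neg_neg, intervalIntegral.integral_neg] at h1
      rw [intervalIntegral.integral_symm x 0, ← h1, neg_neg, ← hvW0 (-x) (by linarith), hve]
  obtain ⟨U, V, hU, hUV⟩ := exists_isOddPeriodicH2 hvc (fun x _ => hve x) hmean hWm hvW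
  have hUpos : ∀ x ∈ Icc 0 Real.pi, U x = s (min x P) - s 0 := fun x hx => by
    rw [(hUV x ⟨by linarith [hx.1], hx.2⟩).2, hvint x hx.1]
  have hUm : MemLp U 2 muPi := memLp_of_continuous hU.continuous 2
  have hUodd : hUm.toLp U ∈ OddL2 := by
    change ∀ᵐ x ∂muPi, hUm.toLp U (-x) = -hUm.toLp U x
    filter_upwards [hUm.coeFn_toLp,
      measurePreserving_neg_muPi.quasiMeasurePreserving.ae hUm.coeFn_toLp] with x h1 h2
    rw [h1, h2, hU.odd]
  set u : OddL2 := ⟨hUm.toLp U, hUodd⟩ with hu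
  have huU : (u : Lp ℂ 2 muPi) =ᵐ[muPi] U := hUm.coeFn_toLp
  -- From `L s = -2 s` and `L 1 = -2 s` one gets `L (s - s 0) = -2 s (1 - s 0) = -2 q₀ s`.
  set g : OddL2 := hs.mulS ((-(2 * q₀ : ℝ) : ℂ) • oddStepL2 P) with hg
  have hstep : (((-(2 * q₀ : ℝ) : ℂ) • oddStepL2 P : OddL2) : Lp ℂ 2 muPi) =ᵐ[muPi]
      fun x => (-(2 * q₀ : ℝ) : ℂ) * oddStep P x := by
    have h1 := Lp.coeFn_smul (-(2 * q₀ : ℝ) : ℂ) (oddStepL2 P : Lp ℂ 2 muPi)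
    filter_upwards [h1, coeFn_oddStepL2 P] with x h1 h2
    refine h1.trans ?_
    rw [Pi.smul_apply, h2, smul_eq_mul]
  have hlin0 : ∀ x ∈ Icc 0 Real.pi,
      linExpr α ψ U V W x = s x * ((-(2 * q₀ : ℝ) : ℂ) * oddStep P x) := by
    intro x hx
    rw [hs.linExpr_eq, (hUV x ⟨by linarith [hx.1], hx.2⟩).1, hUpos x hx]
    rcases hx.1.eq_or_lt with h0 | h0
    · simp only [W]
      rw [← h0, hv0, min_eq_left hP.le, oddStep_zero]
      simp
    · rcases le_or_gt x P with hxP | hxP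
      · have hxm : x ∈ Ioc 0 P := ⟨h0, hxP⟩
        simp only [W]
        rw [hv1 x hxm, min_eq_left hxP, oddStep_of_mem hxm, hs0]
        simp only [w]
        have hα' : (α : ℂ) ≠ 0 := Complex.ofReal_ne_zero.2 hα
        push_cast
        field_simp
        ring
      · simp only [W]
        rw [hv2 x hxP, min_eq_right hxP.le, oddStep_of_lt hP.le hxP, hsP]
        simp
  have hlin : ∀ x ∈ Icc (-Real.pi) Real.pi,
      linExpr α ψ U V W x = s x * ((-(2 * q₀ : ℝ) : ℂ) * oddStep P x) := by
    intro x hx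
    rcases le_total 0 x with h0 | h0
    · exact hlin0 x ⟨h0, hx.2⟩
    · have hx' : -x ∈ Icc (-Real.pi) Real.pi := ⟨by linarith [hx.2], by linarith [hx.1]⟩
      have h1 := hlin0 (-x) ⟨by linarith, by linarith [hx.1]⟩
      rw [hs.linExpr_eq, (hUV _ hx').1, hve, ← (hUV x hx).1, hWneg, hU.odd, h.odd, hs.even,
        oddStep_neg] at h1
      rw [hs.linExpr_eq]
      push_cast at h1 ⊢
      linear_combination -h1
  have hmem : (u, g) ∈ linGraph α ψ := by
    refine ⟨U, V, W, hU, huU, ?_⟩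
    filter_upwards [hs.coeFn_mulS ((-(2 * q₀ : ℝ) : ℂ) • oddStepL2 P), hstep, ae_muPi_mem_Icc]
      with x h1 h2 hx
    rw [hlin x hx]
    refine h1.trans ?_
    rw [h2]
  refine hs.exists_neg_eigenvalue hα hmem ?_
  have hinv : hs.mulInv g = (-(2 * q₀ : ℝ) : ℂ) • oddStepL2 P :=
    (mulOdd_mulOdd _ _ _ _ _ continuous_const (fun _ => rfl)
      fun x => inv_mul_cancel₀ (hs.ne_zero x)).trans (mulOdd_eq_self _ _ (fun _ => rfl) _)
  have hIi : IntervalIntegrable (fun x => (starRingEnd ℂ) (U x) * ((-(2 * q₀ : ℝ) : ℂ) *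
      oddStep P x)) volume (-Real.pi) Real.pi := by
    have h2 : IntervalIntegrable (oddStep P) volume (-Real.pi) Real.pi := by
      refine ⟨?_, ?_⟩
      · refine IntegrableOn.congr_set_ae ?_ Ioo_ae_eq_Ioc.symm
        exact (memLp_oddStep P).integrable (by norm_num)
      · rw [Ioc_eq_empty (by linarith)]
        exact integrableOn_empty
    exact (h2.const_mul _).continuousOn_mul (Complex.continuous_conj.comp hU.continuous).continuousOn
  have hαC : (α : ℂ) ≠ 0 := Complex.ofReal_ne_zero.2 hα
  have hK : ∀ t, HasDerivAt (fun t : ℝ => (((-(2 * q₀)) * (t - α * ψ t - s 0 * t) : ℝ) : ℂ))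
      (((-(2 * q₀)) * (s t - s 0) : ℝ) : ℂ) t := fun t =>
    (((((hasDerivAt_id t).sub ((hψd t).const_mul α)).sub
      ((hasDerivAt_id t).const_mul (s 0))).const_mul (-(2 * q₀))).congr_deriv
        (by field_simp; ring)).ofReal_comp
  have hhalf := integral_truncated (h := fun x => (starRingEnd ℂ) (U x) * ((-(2 * q₀ : ℝ) : ℂ) *
      oddStep P x)) hP.le hπ.le hK (Complex.continuous_ofReal.comp (by fun_prop))
    (fun t ht => by
      rw [hUpos t ⟨ht.1.le, ht.2.trans hPπ⟩, min_eq_left ht.2, oddStep_of_mem ht,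
        ← Complex.ofReal_sub, Complex.conj_ofReal]
      push_cast
      ring)
    (fun t ht => by rw [oddStep_of_lt hP.le ht, mul_zero, mul_zero])
  rw [hinv, inner_OddL2 _ _ huU hstep, integral_eq_two_mul_of_even hπ.le (fun x _ => by
    rw [hU.odd, oddStep_neg, map_neg]
    ring) hIi, hhalf, min_eq_right hPπ, hψP, h.apply_zero, hs0, ← Complex.ofReal_sub,
    ← Complex.ofReal_ofNat, ← Complex.ofReal_mul, Complex.ofReal_re]
  -- The integral of `s - s 0` over a period is `P - s 0 * P = q₀ P`, as `ψ` returns to zero. With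
  -- the factor `-2 q₀` and both halves of the interval, the form equals `-4 q₀² P`.
  have : 0 < q₀ ^ 2 * P := by positivity
  nlinarith

end IsEquilibrium

/-- The condition `2 ≤ j` is what makes a full period `2 π / j` fit into `[0, π]`. -/
theorem psi_exists_neg_eigenvalue {α : ℝ} (hα : α ≠ 0) {j : ℕ} (hj : 2 ≤ j) {ψ : ℝ → ℝ}
    (h : IsPsiPlus α j ψ ∨ IsPsiMinus α j ψ) :
    ∃ l : ℝ, l < 0 ∧ IsUnboundedEigenvalue (linOp α ψ) (l : ℂ) := by
  obtain ⟨he, hp, hd⟩ : IsEquilibrium α ψ ∧ IsFundamentalPeriod ψ (2 * Real.pi / j) ∧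
      deriv ψ 0 ≠ 0 := by
    rcases h with h | h
    · exact ⟨h.1, h.2, h.3.ne'⟩
    · exact ⟨h.1, h.2, h.3.ne⟩
  have hj' : (2 : ℝ) ≤ j := by exact_mod_cast hj
  refine he.exists_neg_eigenvalue hα hp.1.1 ?_ hp.1.2 hd
  rw [div_le_iff₀ (by linarith)]
  nlinarith [Real.pi_pos]

end

/-! ### Conclusion -/

theorem theorem4p3 (α : ℝ) (hα : 0 < α) :
    (2 < α →
      ∃ c : ℝ, 0 < c ∧ ∀ z ∈ unboundedSpectrum (linOp α (fun _ => 0)), z.im = 0 ∧ c ≤ z.re) ∧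
    (α < 2 → ∀ ψ : ℝ → ℝ, IsPsiPlus α 1 ψ ∨ IsPsiMinus α 1 ψ →
      ∃ c : ℝ, 0 < c ∧ ∀ z ∈ unboundedSpectrum (linOp α ψ), z.im = 0 ∧ c ≤ z.re) ∧
    (∀ k : ℕ, 1 ≤ k → 2 / ((k : ℝ) + 1) ^ 2 ≤ α → α < 2 / (k : ℝ) ^ 2 →
      (∃ l : ℝ, l < 0 ∧ (l : ℂ) ∈ unboundedSpectrum (linOp α (fun _ => 0)) ∧
        IsUnboundedEigenvalue (linOp α (fun _ => 0)) (l : ℂ)) ∧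
      ∀ j : ℕ, 2 ≤ j → j ≤ k → ∀ ψ : ℝ → ℝ, IsPsiPlus α j ψ ∨ IsPsiMinus α j ψ →
        ∃ l : ℝ, l < 0 ∧ (l : ℂ) ∈ unboundedSpectrum (linOp α ψ) ∧
          IsUnboundedEigenvalue (linOp α ψ) (l : ℂ)) := by
  refine ⟨fun h => ⟨α - 2, by linarith, fun z hz => spectrum_zero_pos h hz⟩,
    fun _ ψ hψ => spectrum_psi_one_pos hα hψ, fun k hk _ hk2 => ⟨?_, fun j hj _ ψ hψ => ?_⟩⟩
  · have h1 : (1 : ℝ) ≤ (k : ℝ) ^ 2 := one_le_pow₀ (by exact_mod_cast hk)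
    have h2 : 2 / (k : ℝ) ^ 2 ≤ 2 := div_le_self (by norm_num) h1
    have h3 := isUnboundedEigenvalue_zero α
    exact ⟨α - 2, by linarith, h3.mem_unboundedSpectrum, h3⟩
  · obtain ⟨l, hl, h⟩ := psi_exists_neg_eigenvalue hα.ne' hj hψ
    exact ⟨l, hl, h.mem_unboundedSpectrum, h⟩
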